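/- Let $\mathbb D=\{z\in\mathbb C:|z|<1\}$ and let $\mathcal A$ be the class of analytic functions $f$ on $\mathbb D$ with $f(0)=0$, $f'(0)=1$. For $\alpha,\gamma\ge 0$ and $\beta<1$ let $W_\beta(\alpha,\gamma)$ be the set of $f\in\mathcal A$ for which there is $\phi\in\mathbb R$ with $$\mathrm{Re}\Big(e^{i\phi}\Big((1-\alpha+2\gamma)\frac{f(z)}z+(\alpha-2\gamma)f'(z)+\gamma zf''(z)-\beta\Big)\Big)>0\qquad(z\in\mathbb D),$$ and for $0\le\xi\le1$ let $M(\xi)$ be the set of $F\in\mathcal A$ with $$\mathrm{Re}\,\frac{\xi z(zF'(z))'+(1-\xi)zF'(z)}{\xi zF'(z)+(1-\xi)F(z)}>0\qquad(z\in\mathbb D).$$ (Quotients are extended by continuity to $z=0$; in the definition of $M(\xi)$ the denominator must not vanish for $z\neq0$.) Let $\lambda$ be a non-negative integrable function on $(0,1)$ with $\int_0^1\lambda(t)\,dt=1$, let $0\le\xi\le 1$, and let $\mu,\nu>0$ and $\alpha,\gamma$ satisfy $\mu+\nu=\alpha-\gamma$, $\mu\nu=\gamma$. For $0\le t<1$ put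 $$g(t)=2\sum_{n=0}^\infty\frac{(n+1)(-1)^nt^n}{(1+\mu n)(1+\nu n)}-1,\qquad q(t)=\sum_{n=0}^\infty\frac{(n+1)^2(-1)^nt^n}{(1+\mu n)(1+\nu n)},$$ and for $0<t\le 1$ $$\Lambda_\nu(t)=\int_t^1\frac{\lambda(x)}{x^{1/\nu}}\,dx,\qquad \Pi_{\mu,\nu}(t)=\int_t^1\Lambda_\nu(x)\,x^{1/\nu-1-1/\mu}\,dx .$$ For $|\varepsilon|=1$ let $h_\varepsilon(z)=\dfrac{z\left(1+\frac{\varepsilon-1}2z\right)}{(1-z)^2}$ and $$N_{\Pi_{\mu,\nu}}(h_\varepsilon)=\inf_{z\in\mathbb D}\int_0^1t^{1/\mu-1}\,\Pi_{\mu,\nu}(t)\left[(1-\xi)\left(\mathrm{Re}\,\frac{h_\varepsilon(tz)}{tz}-\frac1{(1+t)^2}\right)+\xi\left(\mathrm{Re}\,h_\varepsilon'(tz)-\frac{1-t}{(1+t)^3}\right)\right]dt\in[-\infty,\infty).$$ Let $\rho<1$ and $\beta<1$ satisfy $$\frac1{2(1-\beta)(1-\rho)}=\int_0^1\lambda(t)\left[(1-\xi)\,\frac{1-g(t)}2+\xi\,(1-q(t))\right]dt,$$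 and for $f\in\mathcal A$ define, with $*$ the Hadamard product of power series, $$\mathcal V_\lambda(f)(z)=\left(z\int_0^1\lambda(t)\,\frac{1-\rho tz}{1-tz}\,dt\right)*f(z).$$ Then $\mathcal V_\lambda(f)(z)=\rho z+(1-\rho)\displaystyle\int_0^1\lambda(t)\frac{f(tz)}t\,dt$ for all $f\in\mathcal A$ and $z\in\mathbb D$, and $$\mathcal V_\lambda\big(W_\beta(\alpha,\gamma)\big)\subset M(\xi)\quad\Longleftrightarrow\quad N_{\Pi_{\mu,\nu}}(h_\varepsilon)\ge0\ \text{ for every }\varepsilon\in\mathbb C\text{ with }|\varepsilon|=1 .$$ -/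

import Mathlib

noncomputable section

namespace Pascu

/-- The open unit disc of the complex plane. -/
def unitDisc : Set ℂ := Metric.ball 0 1

/-- Normalized analytic functions on the unit disc: `f 0 = 0` and `f' 0 = 1`.
Values outside the disc are irrelevant. -/
def classA : Set (ℂ → ℂ) :=
  {f | DifferentiableOn ℂ f unitDisc ∧ f 0 = 0 ∧ deriv f 0 = 1}

/-- The class `W_β(α, γ)`. For `f 0 = 0`, `dslope f 0 z` is the analytic function `f z / z`,
with value `f' 0` at `z = 0`. -/
def classW (β α γ : ℝ) : Set (ℂ → ℂ) :=
  {f | f ∈ classA ∧ ∃ φ : ℝ, ∀ z ∈ unitDisc,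
    0 < (Complex.exp (Complex.I * (φ : ℂ)) *
      ((1 - α + 2 * γ : ℂ) * dslope f 0 z + (α - 2 * γ : ℂ) * deriv f z
        + (γ : ℂ) * z * deriv (deriv f) z - (β : ℂ))).re}

/-- The Pascu class `M(ξ)`. At `z = 0` the quotient has a removable singularity with value `1`,
so the condition is imposed at the other points of the disc, where the denominator must not
vanish. -/
def classM (ξ : ℝ) : Set (ℂ → ℂ) :=
  {F | F ∈ classA ∧ ∀ z ∈ unitDisc, z ≠ 0 →
    (ξ : ℂ) * z * deriv F z + (1 - ξ : ℂ) * F z ≠ 0 ∧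
    0 < (((ξ : ℂ) * z * deriv (fun w => w * deriv F w) z + (1 - ξ : ℂ) * z * deriv F z) /
      ((ξ : ℂ) * z * deriv F z + (1 - ξ : ℂ) * F z)).re}

/-- The `n`-th Taylor coefficient at the origin. -/
def taylorCoeff (f : ℂ → ℂ) (n : ℕ) : ℂ := iteratedDeriv n f 0 / (n.factorial : ℂ)

/-- The Hadamard product (convolution) of two functions analytic in the unit disc. -/
def hadamard (f g : ℂ → ℂ) (z : ℂ) : ℂ := ∑' n : ℕ, taylorCoeff f n * taylorCoeff g n * z ^ n

/-- The integral transform `V_λ(f)(z) = ∫₀¹ λ(t) f(tz)/t dt`. -/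
def opV (lam : ℝ → ℝ) (f : ℂ → ℂ) (z : ℂ) : ℂ :=
  ∫ t in (0 : ℝ)..1, (lam t : ℂ) * (f ((t : ℂ) * z) / (t : ℂ))

/-- The generalized operator: the Hadamard product of `z ∫₀¹ λ(t) (1 - ρtz)/(1 - tz) dt`
with `f`. -/
def opGenV (lam : ℝ → ℝ) (ρ : ℝ) (f : ℂ → ℂ) : ℂ → ℂ :=
  hadamard
    (fun z : ℂ => z * ∫ t in (0 : ℝ)..1,
      (lam t : ℂ) * ((1 - (ρ : ℂ) * (t : ℂ) * z) / (1 - (t : ℂ) * z)))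
    f

/-- The auxiliary function `g`, given by its series for `0 ≤ t < 1`. -/
def auxG (μ ν t : ℝ) : ℝ :=
  2 * (∑' n : ℕ, ((n : ℝ) + 1) * (-1) ^ n * t ^ n / ((1 + μ * n) * (1 + ν * n))) - 1

/-- The auxiliary function `q`, given by its series for `0 ≤ t < 1`. -/
def auxQ (μ ν t : ℝ) : ℝ :=
  ∑' n : ℕ, ((n : ℝ) + 1) ^ 2 * (-1) ^ n * t ^ n / ((1 + μ * n) * (1 + ν * n))

/-- `Λ_ν(t) = ∫_t^1 λ(x) x^(-1/ν) dx`, for `0 < t ≤ 1`. -/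
def bigLambda (lam : ℝ → ℝ) (ν t : ℝ) : ℝ := ∫ x in t..1, lam x / x ^ (1 / ν)

/-- `Π_{μ,ν}(t) = ∫_t^1 Λ_ν(x) x^(1/ν - 1 - 1/μ) dx`, for `0 < t ≤ 1` (case `μ, ν > 0`). -/
def bigPi (lam : ℝ → ℝ) (μ ν t : ℝ) : ℝ :=
  ∫ x in t..1, bigLambda lam ν x * x ^ (1 / ν - 1 - 1 / μ)

/-- `h(z) = z (1 + (ε - 1) z / 2) / (1 - z)^2`. -/
def funH (ε z : ℂ) : ℂ := z * (1 + (ε - 1) / 2 * z) / (1 - z) ^ 2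

/-- `L_{ξ,z}(t)`. Here `dslope (funH ε) 0 w` is `h(w)/w`, with value `h'(0) = 1` at `w = 0`. -/
def funL (ξ : ℝ) (ε z : ℂ) (t : ℝ) : ℝ :=
  (1 - ξ) * ((dslope (funH ε) 0 ((t : ℂ) * z)).re - 1 / (1 + t) ^ 2)
    + ξ * ((deriv (funH ε) ((t : ℂ) * z)).re - (1 - t) / (1 + t) ^ 3)

/-- `N_Π(h)`: the infimum over the unit disc of `∫₀¹ t^(1/μ - 1) Π_{μ,ν}(t) L_{ξ,z}(t) dt`.
It is taken in the extended reals, since the integrals may be unbounded below. -/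
def funN (lam : ℝ → ℝ) (μ ν ξ : ℝ) (ε : ℂ) : EReal :=
  ⨅ z ∈ unitDisc,
    ((∫ t in (0 : ℝ)..1, t ^ (1 / μ - 1) * bigPi lam μ ν t * funL ξ ε z t : ℝ) : EReal)

end Pascu

end

noncomputable section

namespace Pascu

open Metric Filter Topology

/-! The argument is Ruscheweyh duality carried out on Taylor coefficients. Let τₙ be the moments of
`lam`, let f = Σ aₙ zⁿ lie in the class W, and let p be the expression that must lie in a half
plane. Since μ + ν = α - γ and μν = γ, p has coefficients (1 + μn)(1 + νn) aₙ₊₁, with p(0) = 1. The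
transform multiplies aₙ₊₁ by (1 - ρ) τₙ for n ≥ 1 and leaves a₁ = 1 alone.

A quotient equal to 1 at the origin keeps positive real part exactly when it never meets the
imaginary axis. The map q ↦ (1 + q)/(q - 1), up to sign, sends that axis into the unit circle, so
membership in M(ξ) says that for every |ε| = 1 a convolution has no zero (`mem_classM_iff`). For the
transform of f this convolution is 1 + c * p, with c given by `criterionCoeff`.

Over all admissible p, 1 + c * p is zero-free if and only if Re c ≥ -1/(2(1 - β)) on the disc.
Sufficiency writes c * p as a circle average of c against the positive weight Re(e^{iφ}(p - β))
(`one_add_powerSum_mul_taylorCoeff_ne_zero`). Necessity uses the extremal functions p = 1 + (1 -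
β)(1 + η) z/(1 - z), |η| = 1 (`exists_one_add_mul_powerSum_eq_zero`).

Finally, the integral in `funN` equals μν/(1 - ρ) · (Re c(z) + 1/(2(1 - β)))
(`integral_bigPi_mul_funL`). Two uses of Fubini show that the weight built from Π has moments μν
τₙ/((1 + μn)(1 + νn)), and the relation between β and ρ evaluates the subtracted terms, which are
the kernel for ε = 1 on the negative radius. -/

/-- The sum of the power series with coefficients `a`. -/
def powerSum (a : ℕ → ℂ) (z : ℂ) : ℂ := ∑' n : ℕ, a n * z ^ n

/-- The power series with coefficients `a` converges in the unit disc. -/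
def DiscSummable (a : ℕ → ℂ) : Prop :=
  ∀ r : ℝ, 0 ≤ r → r < 1 → Summable fun n => ‖a n‖ * r ^ n

theorem mem_unitDisc {z : ℂ} : z ∈ unitDisc ↔ ‖z‖ < 1 := by simp [unitDisc]

theorem isOpen_unitDisc : IsOpen unitDisc := isOpen_ball

theorem zero_mem_unitDisc : (0 : ℂ) ∈ unitDisc := by simp [mem_unitDisc]

theorem isPreconnected_unitDisc : IsPreconnected unitDisc :=
  (convex_ball (0 : ℂ) 1).isPreconnected

/-! ### Coefficient sequences of power series convergent in the disc. -/

section Sequences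

variable {a b : ℕ → ℂ}

theorem DiscSummable.summable_norm (h : DiscSummable a) {z : ℂ} (hz : ‖z‖ < 1) :
    Summable fun n => ‖a n * z ^ n‖ := by
  simpa using h ‖z‖ (norm_nonneg z) hz

theorem DiscSummable.hasSum (h : DiscSummable a) {z : ℂ} (hz : ‖z‖ < 1) :
    HasSum (fun n => a n * z ^ n) (powerSum a z) :=
  (h.summable_norm hz).of_norm.hasSum

theorem discSummable_of_summable (h : ∀ z : ℂ, ‖z‖ < 1 → Summable fun n => a n * z ^ n) :
    DiscSummable a := by
  intro r hr0 hr1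
  have h1 := summable_norm_iff.2 (h (r : ℂ) (by simpa [abs_of_nonneg hr0] using hr1))
  simpa [abs_of_nonneg hr0] using h1

/-- Each of the n + 1 terms q ^ i with i ≤ n is at least q ^ n, and together they stay below the
full geometric series. -/
theorem succ_mul_pow_le {q : ℝ} (hq0 : 0 ≤ q) (hq1 : q < 1) (n : ℕ) :
    ((n : ℝ) + 1) * q ^ n ≤ (1 - q)⁻¹ := by
  calc ((n : ℝ) + 1) * q ^ n = ∑ _i ∈ Finset.range (n + 1), q ^ n := by simp
    _ ≤ ∑ i ∈ Finset.range (n + 1), q ^ i := by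
        refine Finset.sum_le_sum fun i hi => pow_le_pow_of_le_one hq0 hq1.le ?_
        have := Finset.mem_range.1 hi
        omega
    _ ≤ ∑' i : ℕ, q ^ i :=
        (summable_geometric_of_lt_one hq0 hq1).sum_le_tsum _ fun i _ => pow_nonneg hq0 i
    _ = (1 - q)⁻¹ := tsum_geometric_of_lt_one hq0 hq1

/-- Multiplying the coefficients by a factor of at most linear growth preserves convergence. -/
theorem DiscSummable.of_le (h : DiscSummable a) (C : ℝ)
    (hb : ∀ n, ‖b n‖ ≤ C * ((n : ℝ) + 1) * ‖a n‖) : DiscSummable b := by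
  intro r hr0 hr1
  -- An intermediate radius: the decay of (r / s) ^ n absorbs the linear factor.
  obtain ⟨s, hrs, hs1⟩ := exists_between hr1
  have hs0 : 0 < s := hr0.trans_lt hrs
  have hq0 : 0 ≤ r / s := by positivity
  have hq1 : r / s < 1 := (div_lt_one hs0).2 hrs
  refine Summable.of_nonneg_of_le (fun _ => by positivity) (fun n => ?_)
    ((h s hs0.le hs1).mul_left (|C| * (1 - r / s)⁻¹))
  have h1 : r ^ n = (r / s) ^ n * s ^ n := by
    rw [← mul_pow, div_mul_cancel₀ _ hs0.ne']
  have h2 := succ_mul_pow_le hq0 hq1 n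
  calc ‖b n‖ * r ^ n ≤ (|C| * ((n : ℝ) + 1) * ‖a n‖) * r ^ n := by
        gcongr
        refine (hb n).trans ?_
        gcongr
        exact le_abs_self C
    _ = |C| * (((n : ℝ) + 1) * (r / s) ^ n) * (‖a n‖ * s ^ n) := by rw [h1]; ring
    _ ≤ |C| * (1 - r / s)⁻¹ * (‖a n‖ * s ^ n) := by gcongr

theorem DiscSummable.of_le_const (h : DiscSummable a) (C : ℝ)
    (hb : ∀ n, ‖b n‖ ≤ C * ‖a n‖) : DiscSummable b := by
  intro r hr0 hr1
  refine Summable.of_nonneg_of_le (fun _ => by positivity) (fun n => ?_)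
    ((h r hr0 hr1).mul_left C)
  calc ‖b n‖ * r ^ n ≤ C * ‖a n‖ * r ^ n := by gcongr; exact hb n
    _ = _ := by ring

theorem discSummable_one : DiscSummable fun _ => 1 := by
  intro r hr0 hr1
  simpa using summable_geometric_of_lt_one hr0 hr1

theorem DiscSummable.add (ha : DiscSummable a) (hb : DiscSummable b) :
    DiscSummable fun n => a n + b n := by
  intro r hr0 hr1
  refine Summable.of_nonneg_of_le (fun _ => by positivity) (fun n => ?_)
    ((ha r hr0 hr1).add (hb r hr0 hr1))
  rw [← add_mul]
  gcongr
  exact norm_add_le _ _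

theorem DiscSummable.const_mul (ha : DiscSummable a) (c : ℂ) :
    DiscSummable fun n => c * a n :=
  ha.of_le_const ‖c‖ fun _ => (norm_mul _ _).le

theorem DiscSummable.natCast_mul (ha : DiscSummable a) :
    DiscSummable fun n => (n : ℂ) * a n :=
  ha.of_le 1 fun n => by
    rw [norm_mul, one_mul, Complex.norm_natCast]
    gcongr
    linarith

theorem DiscSummable.shift (ha : DiscSummable a) : DiscSummable fun n => a (n + 1) := by
  -- The index shift costs a division by r, so r = 0 is recovered afterwards by comparison with the
  -- larger radius (r + 1) / 2.
  have key : ∀ r : ℝ, 0 < r → r < 1 → Summable fun n => ‖a (n + 1)‖ * r ^ n := by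
    intro r hr0 hr1
    have h1 := ((summable_nat_add_iff 1).2 (ha r hr0.le hr1)).mul_left r⁻¹
    refine h1.congr fun n => ?_
    rw [pow_succ]
    field_simp
  intro r hr0 hr1
  refine Summable.of_nonneg_of_le (fun _ => by positivity) (fun n => ?_)
    (key ((r + 1) / 2) (by linarith) (by linarith))
  gcongr
  linarith

theorem DiscSummable.of_shift (ha : DiscSummable fun n => a (n + 1)) : DiscSummable a := by
  intro r hr0 hr1
  refine (summable_nat_add_iff 1).1 (((ha r hr0 hr1).mul_left r).congr fun n => ?_)
  rw [pow_succ]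
  ring

theorem DiscSummable.mul_geom (ha : DiscSummable a) {w : ℂ} (hw : ‖w‖ ≤ 1) :
    DiscSummable fun n => a n * w ^ n :=
  ha.of_le_const 1 fun n => by
    rw [norm_mul, norm_pow, one_mul]
    exact mul_le_of_le_one_right (norm_nonneg _) (pow_le_one₀ (norm_nonneg _) hw)

/-- Writing r ^ n as a square of √r ^ n gives one factor to each sequence: the first product is
bounded, the second summable. -/
theorem DiscSummable.mul (ha : DiscSummable a) (hb : DiscSummable b) :
    DiscSummable fun n => a n * b n := by
  intro r hr0 hr1
  have hs : Real.sqrt r < 1 := by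
    rw [Real.sqrt_lt' one_pos]
    simpa using hr1
  have h1 := ha _ (Real.sqrt_nonneg r) hs
  have h2 := hb _ (Real.sqrt_nonneg r) hs
  obtain ⟨M, hM⟩ := h1.tendsto_atTop_zero.bddAbove_range
  refine Summable.of_nonneg_of_le (fun _ => by positivity) (fun n => ?_) (h2.mul_left M)
  have h3 : r ^ n = Real.sqrt r ^ n * Real.sqrt r ^ n := by
    rw [← mul_pow, Real.mul_self_sqrt hr0]
  calc ‖a n * b n‖ * r ^ n = (‖a n‖ * Real.sqrt r ^ n) * (‖b n‖ * Real.sqrt r ^ n) := by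
        rw [norm_mul, h3]
        ring
    _ ≤ M * (‖b n‖ * Real.sqrt r ^ n) := by
        gcongr
        exact hM ⟨n, rfl⟩

theorem powerSum_mul_pow (a : ℕ → ℂ) (w z : ℂ) :
    powerSum (fun n => a n * w ^ n) z = powerSum a (w * z) := by
  simp only [powerSum, mul_pow, mul_assoc]

theorem powerSum_zero (a : ℕ → ℂ) : powerSum a 0 = a 0 := by
  rw [powerSum, tsum_eq_single 0]
  · simp
  · intro n hn
    simp [hn]

theorem powerSum_add (ha : DiscSummable a) (hb : DiscSummable b) {z : ℂ} (hz : ‖z‖ < 1) :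
    powerSum (fun n => a n + b n) z = powerSum a z + powerSum b z := by
  rw [← ((ha.hasSum hz).add (hb.hasSum hz)).tsum_eq]
  simp only [powerSum, add_mul]

theorem powerSum_const_mul (a : ℕ → ℂ) (c z : ℂ) :
    powerSum (fun n => c * a n) z = c * powerSum a z := by
  simp only [powerSum, mul_assoc, tsum_mul_left]

theorem powerSum_eq_zero_add (ha : DiscSummable a) {z : ℂ} (hz : ‖z‖ < 1) :
    powerSum a z = a 0 + z * powerSum (fun n => a (n + 1)) z := by
  rw [powerSum, (ha.hasSum hz).summable.tsum_eq_zero_add, powerSum, ← tsum_mul_left]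
  simp only [pow_zero, mul_one, pow_succ]
  congr 1
  exact tsum_congr fun n => by ring

theorem DiscSummable.hasFPowerSeriesOnBall (ha : DiscSummable a) :
    HasFPowerSeriesOnBall (powerSum a) (FormalMultilinearSeries.ofScalars ℂ a) 0 1 where
  r_le := by
    refine ENNReal.le_of_forall_nnreal_lt fun r hr => ?_
    refine FormalMultilinearSeries.le_radius_of_summable _ ?_
    simp only [FormalMultilinearSeries.ofScalars_norm]
    exact ha r r.2 (by exact_mod_cast hr)
  r_pos := one_pos
  hasSum := by
    intro y hy
    have hy' : ‖y‖ < 1 := by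
      have h1 : y ∈ Metric.eball (0 : ℂ) (1 : NNReal) := by simpa using hy
      rw [Metric.eball_coe] at h1
      simpa using h1
    have h1 := ha.hasSum hy'
    simpa [FormalMultilinearSeries.ofScalars_apply_eq', smul_eq_mul, mul_comm] using h1

theorem DiscSummable.differentiableOn (ha : DiscSummable a) :
    DifferentiableOn ℂ (powerSum a) unitDisc := by
  have h1 := ha.hasFPowerSeriesOnBall.differentiableOn
  have h2 : Metric.eball (0 : ℂ) (1 : NNReal) = ball 0 1 := by rw [Metric.eball_coe]; simp
  rw [ENNReal.coe_one] at h2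
  rwa [h2] at h1

theorem DiscSummable.taylorCoeff_powerSum (ha : DiscSummable a) :
    taylorCoeff (powerSum a) = a := by
  have h1 := ha.hasFPowerSeriesOnBall.hasFPowerSeriesAt
  have h2 := h1.analyticAt.hasFPowerSeriesAt
  exact FormalMultilinearSeries.ofScalars_series_injective ℂ ℂ
    (h2.eq_formalMultilinearSeries h1)

end Sequences

/-! ### Taylor coefficients of analytic functions, their derivatives and difference quotients. -/

section Functions

variable {f g : ℂ → ℂ} {a : ℕ → ℂ}

theorem taylorCoeff_congr (h : Set.EqOn f g unitDisc) : taylorCoeff f = taylorCoeff g := by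
  have h1 : f =ᶠ[𝓝 0] g := h.eventuallyEq_of_mem (isOpen_unitDisc.mem_nhds zero_mem_unitDisc)
  funext n
  rw [taylorCoeff, taylorCoeff, h1.iteratedDeriv_eq]

theorem taylorCoeff_eq_of_eqOn (ha : DiscSummable a) (h : Set.EqOn f (powerSum a) unitDisc) :
    taylorCoeff f = a := by
  rw [taylorCoeff_congr h, ha.taylorCoeff_powerSum]

theorem differentiableOn_of_eqOn (ha : DiscSummable a) (h : Set.EqOn f (powerSum a) unitDisc) :
    DifferentiableOn ℂ f unitDisc :=
  ha.differentiableOn.congr h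

theorem hasSum_taylorCoeff (hf : DifferentiableOn ℂ f unitDisc) {z : ℂ} (hz : ‖z‖ < 1) :
    HasSum (fun n => taylorCoeff f n * z ^ n) (f z) := by
  have h1 := Complex.hasSum_taylorSeries_on_ball hf (mem_unitDisc.2 hz)
  refine h1.congr_fun fun n => ?_
  simp only [taylorCoeff, sub_zero, smul_eq_mul]
  ring

theorem discSummable_taylorCoeff (hf : DifferentiableOn ℂ f unitDisc) :
    DiscSummable (taylorCoeff f) :=
  discSummable_of_summable fun _ hz => (hasSum_taylorCoeff hf hz).summable

theorem eqOn_powerSum_taylorCoeff (hf : DifferentiableOn ℂ f unitDisc) :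
    Set.EqOn f (powerSum (taylorCoeff f)) unitDisc :=
  fun _ hz => (hasSum_taylorCoeff hf (mem_unitDisc.1 hz)).tsum_eq.symm

theorem taylorCoeff_zero (f : ℂ → ℂ) : taylorCoeff f 0 = f 0 := by simp [taylorCoeff]

theorem taylorCoeff_one (f : ℂ → ℂ) : taylorCoeff f 1 = deriv f 0 := by simp [taylorCoeff]

theorem taylorCoeff_deriv (f : ℂ → ℂ) (n : ℕ) :
    taylorCoeff (deriv f) n = ((n : ℂ) + 1) * taylorCoeff f (n + 1) := by
  rw [taylorCoeff, taylorCoeff, ← iteratedDeriv_succ', Nat.factorial_succ]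
  have h1 : (n.factorial : ℂ) ≠ 0 := by exact_mod_cast n.factorial_ne_zero
  have h2 : (n : ℂ) + 1 ≠ 0 := by exact_mod_cast n.succ_ne_zero
  push_cast
  field_simp

theorem DiscSummable.deriv (ha : DiscSummable a) :
    DiscSummable fun n => ((n : ℂ) + 1) * a (n + 1) :=
  ha.shift.of_le 1 fun n => by
    rw [norm_mul, one_mul]
    gcongr
    exact (norm_add_le _ _).trans (by simp)

theorem deriv_eqOn (ha : DiscSummable a) (h : Set.EqOn f (powerSum a) unitDisc) :
    Set.EqOn (deriv f) (powerSum fun n => ((n : ℂ) + 1) * a (n + 1)) unitDisc := by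
  have h1 := (differentiableOn_of_eqOn ha h).deriv isOpen_unitDisc
  have h2 := eqOn_powerSum_taylorCoeff h1
  have h3 : taylorCoeff (deriv f) = fun n : ℕ => ((n : ℂ) + 1) * a (n + 1) := by
    funext n
    rw [taylorCoeff_deriv, taylorCoeff_eq_of_eqOn ha h]
  rwa [h3] at h2

/-- The Euler operator `z d/dz` multiplies the `n`-th coefficient by `n`. -/
theorem mul_deriv_eqOn (ha : DiscSummable a) (h : Set.EqOn f (powerSum a) unitDisc) :
    Set.EqOn (fun z => z * deriv f z) (powerSum fun n => (n : ℂ) * a n) unitDisc := by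
  intro z hz
  simp only [deriv_eqOn ha h hz]
  rw [powerSum_eq_zero_add ha.natCast_mul (mem_unitDisc.1 hz)]
  simp

theorem dslope_eqOn (ha : DiscSummable a) (h : Set.EqOn f (powerSum a) unitDisc) :
    Set.EqOn (dslope f 0) (powerSum fun n => a (n + 1)) unitDisc := by
  intro z hz
  rcases eq_or_ne z 0 with rfl | h0
  · rw [dslope_same, ← taylorCoeff_one, taylorCoeff_eq_of_eqOn ha h, powerSum_zero]
  · rw [dslope_of_ne _ h0, slope_def_field, h hz, h zero_mem_unitDisc, powerSum_zero,
      powerSum_eq_zero_add ha (mem_unitDisc.1 hz)]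
    field_simp
    ring

end Functions

end Pascu

end

/-! ### Non-vanishing criteria: the class M(ξ) and the duality with half planes. -/

noncomputable section

namespace Pascu

open Metric Filter Topology

/-- The choice ε = -1 shows that G has no zero. If q = N / G were purely imaginary somewhere, ε = (1
+ q) / (1 - q) would be unimodular and violate the hypothesis. Thus Re q never vanishes, and it
equals 1 at the origin of a connected disc. -/
theorem re_div_pos_of_forall_ne_zero {N G : ℂ → ℂ} (hN : ContinuousOn N unitDisc)
    (hG : ContinuousOn G unitDisc) (h0 : N 0 = G 0)
    (h : ∀ ε : ℂ, ‖ε‖ = 1 → ∀ z ∈ unitDisc, (1 - ε) * G z + (1 + ε) * N z ≠ 0)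
    {z : ℂ} (hz : z ∈ unitDisc) : G z ≠ 0 ∧ 0 < (N z / G z).re := by
  have hG0 : ∀ w ∈ unitDisc, G w ≠ 0 := by
    intro w hw h1
    exact h (-1) (by simp) w hw (by rw [h1]; ring)
  have hre : ∀ w ∈ unitDisc, (N w / G w).re ≠ 0 := by
    intro w hw h1
    set q := N w / G w with hq
    have hq1 : 1 - q ≠ 0 := by
      intro h2
      have h3 := congrArg Complex.re h2
      simp [h1] at h3
    have hnorm : ‖1 + q‖ = ‖1 - q‖ := by
      rw [← sq_eq_sq₀ (norm_nonneg _) (norm_nonneg _), ← Complex.normSq_eq_norm_sq,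
        ← Complex.normSq_eq_norm_sq, Complex.normSq_apply, Complex.normSq_apply]
      simp [h1]
    refine h ((1 + q) / (1 - q)) ?_ w hw ?_
    · rw [norm_div, hnorm, div_self (norm_ne_zero_iff.2 hq1)]
    · have h2 : N w = q * G w := by rw [hq, div_mul_cancel₀ _ (hG0 w hw)]
      rw [h2]
      field_simp
      ring
  refine ⟨hG0 z hz, ?_⟩
  by_contra hneg
  have hcont : ContinuousOn (fun w => (N w / G w).re) unitDisc :=
    Complex.continuous_re.comp_continuousOn (hN.div hG hG0)
  have hmem : (0 : ℝ) ∈ Set.Icc (N z / G z).re (N 0 / G 0).re := by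
    refine ⟨not_lt.1 hneg, ?_⟩
    rw [h0, div_self (hG0 0 zero_mem_unitDisc)]
    simp
  obtain ⟨w, hw, hw0⟩ :=
    isPreconnected_unitDisc.intermediate_value hz zero_mem_unitDisc hcont hmem
  exact hre w hw hw0

/-- A function belongs to the Pascu class if and only if its convolutions with the functions
`ξ z h' + (1 - ξ) h`, `h = funH ε`, do not vanish away from the origin. -/
theorem mem_classM_iff {ξ : ℝ} {F : ℂ → ℂ} {b : ℕ → ℂ} (hb : DiscSummable b)
    (hF : Set.EqOn F (powerSum b) unitDisc) (hb0 : b 0 = 0) (hb1 : b 1 = 1) :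
    F ∈ classM ξ ↔ ∀ ε : ℂ, ‖ε‖ = 1 → ∀ z : ℂ, ‖z‖ < 1 →
      powerSum (fun n => (1 + ξ * n) * (1 + n * ((1 + ε) / 2)) * b (n + 1)) z ≠ 0 := by
  have hFA : F ∈ classA := by
    have h1 := taylorCoeff_eq_of_eqOn hb hF
    refine ⟨differentiableOn_of_eqOn hb hF, ?_, ?_⟩
    · rw [← taylorCoeff_zero F, h1, hb0]
    · rw [← taylorCoeff_one F, h1, hb1]
  -- The denominator is z times the series of `d`, the numerator z times the series of `e` below, so
  -- z cancels in the quotient.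
  set d : ℕ → ℂ := fun n => (1 + ξ * n) * b (n + 1) with hd_def
  have hd : DiscSummable d := by
    have h1 := hb.shift.add (hb.shift.natCast_mul.const_mul ξ)
    convert h1 using 2 with n
    rw [hd_def]
    ring
  set e : ℕ → ℂ := fun n => d n + n * d n with he_def
  have he : DiscSummable e := hd.add hd.natCast_mul
  have hb' := hb.natCast_mul
  have h1F := mul_deriv_eqOn hb hF
  have h2F := mul_deriv_eqOn hb' h1F
  have hden : ∀ z : ℂ, ‖z‖ < 1 →
      (ξ : ℂ) * z * deriv F z + (1 - ξ : ℂ) * F z = z * powerSum d z := by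
    intro z hz
    have h1 : z * deriv F z = powerSum (fun n => (n : ℂ) * b n) z := h1F (mem_unitDisc.2 hz)
    rw [mul_assoc, h1, hF (mem_unitDisc.2 hz), ← powerSum_const_mul, ← powerSum_const_mul,
      ← powerSum_add (hb'.const_mul _) (hb.const_mul _) hz,
      powerSum_eq_zero_add ((hb'.const_mul _).add (hb.const_mul _)) hz]
    simp only [hb0, mul_zero, add_zero, zero_add]
    congr 2
    funext n
    rw [hd_def]
    push_cast
    ring
  have hnum : ∀ z : ℂ, ‖z‖ < 1 →
      (ξ : ℂ) * z * deriv (fun w => w * deriv F w) z + (1 - ξ : ℂ) * z * deriv F z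
        = z * powerSum e z := by
    intro z hz
    have h1 : z * deriv F z = powerSum (fun n => (n : ℂ) * b n) z := h1F (mem_unitDisc.2 hz)
    have h2 : z * deriv (fun w => w * deriv F w) z
      = powerSum (fun n => (n : ℂ) * (n * b n)) z := h2F (mem_unitDisc.2 hz)
    rw [mul_assoc, h2, mul_assoc, h1, ← powerSum_const_mul, ← powerSum_const_mul,
      ← powerSum_add (hb'.natCast_mul.const_mul _) (hb'.const_mul _) hz,
      powerSum_eq_zero_add ((hb'.natCast_mul.const_mul _).add (hb'.const_mul _)) hz]
    simp only [hb0, mul_zero, add_zero, zero_add]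
    congr 2
    funext n
    rw [he_def, hd_def]
    push_cast
    ring
  have hS : ∀ ε z : ℂ, ‖z‖ < 1 →
      powerSum (fun n => (1 + ξ * n) * (1 + n * ((1 + ε) / 2)) * b (n + 1)) z
        = ((1 - ε) * powerSum d z + (1 + ε) * powerSum e z) / 2 := by
    intro ε z hz
    have h1 : powerSum (fun n => (1 - ε) / 2 * d n + (1 + ε) / 2 * e n) z
        = ((1 - ε) * powerSum d z + (1 + ε) * powerSum e z) / 2 := by
      rw [powerSum_add (hd.const_mul _) (he.const_mul _) hz, powerSum_const_mul,
        powerSum_const_mul]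
      ring
    rw [← h1]
    congr 1
    funext n
    simp only [he_def, hd_def]
    ring
  constructor
  · rintro ⟨-, hM⟩ ε hε z hz hzero
    rw [hS ε z hz] at hzero
    rcases eq_or_ne z 0 with rfl | hz0
    · rw [powerSum_zero, powerSum_zero] at hzero
      simp [hd_def, he_def, hb1] at hzero
    · obtain ⟨hne, hpos⟩ := hM z (mem_unitDisc.2 hz) hz0
      rw [hden z hz] at hne
      rw [hden z hz, hnum z hz, mul_div_mul_left _ _ hz0] at hpos
      have hne' : powerSum d z ≠ 0 := right_ne_zero_of_mul hne
      set q := powerSum e z / powerSum d z with hq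
      have h1 : powerSum e z = q * powerSum d z := by rw [hq, div_mul_cancel₀ _ hne']
      rw [h1] at hzero
      have h2 : (1 + q) = ε * (1 - q) := by
        have h3 : ((1 - ε) + (1 + ε) * q) * powerSum d z = 0 := by
          linear_combination 2 * hzero
        rcases mul_eq_zero.1 h3 with h3 | h3
        · linear_combination h3
        · exact absurd h3 hne'
      -- Equal distances from q to 1 and to -1 force Re q = 0, against `hpos`.
      have h3 : ‖1 + q‖ ^ 2 = ‖1 - q‖ ^ 2 := by rw [h2, norm_mul, hε, one_mul]
      rw [← Complex.normSq_eq_norm_sq, ← Complex.normSq_eq_norm_sq, Complex.normSq_apply,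
        Complex.normSq_apply] at h3
      simp only [Complex.add_re, Complex.sub_re, Complex.add_im, Complex.sub_im,
        Complex.one_re, Complex.one_im] at h3
      nlinarith
  · intro h
    refine ⟨hFA, fun z hz hz0 => ?_⟩
    have hz' := mem_unitDisc.1 hz
    have h1 := re_div_pos_of_forall_ne_zero he.differentiableOn.continuousOn
      hd.differentiableOn.continuousOn (by simp [powerSum_zero, he_def])
      (fun ε hε w hw hzero => h ε hε w (mem_unitDisc.1 hw) (by
        rw [hS ε w (mem_unitDisc.1 hw), hzero, zero_div])) hz
    rw [hden z hz', hnum z hz', mul_div_mul_left _ _ hz0]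
    exact ⟨mul_ne_zero hz0 h1.1, h1.2⟩

/-- At a zero of X the modulus of exp(-X) would attain its maximum 1; the maximum principle then
gives modulus 1 at the origin too, contradicting Re X(0) > 0. -/
theorem ne_zero_of_re_nonneg {X : ℂ → ℂ} (hX : DifferentiableOn ℂ X unitDisc)
    (hre : ∀ z ∈ unitDisc, 0 ≤ (X z).re) (h0 : 0 < (X 0).re) {z : ℂ} (hz : z ∈ unitDisc) :
    X z ≠ 0 := by
  intro hzero
  have hmax : IsMaxOn (norm ∘ fun w => Complex.exp (-X w)) unitDisc z := by
    intro w hw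
    simp only [Function.comp_apply, Set.mem_ofPred_eq, Complex.norm_exp, hzero]
    simpa using hre w hw
  have h1 := Complex.norm_eqOn_of_isPreconnected_of_isMaxOn isPreconnected_unitDisc
    isOpen_unitDisc (hX.neg.cexp) hz hmax zero_mem_unitDisc
  simp [Complex.norm_exp, hzero] at h1
  exact h0.ne' h1

/-! ### Circle averages: coefficients recovered from the real part. -/

section CircleAverage

variable {Q : ℂ → ℂ} {r : ℝ}

theorem mem_unitDisc_of_mem_sphere (hr1 : r < 1) {u : ℂ} (hu : u ∈ sphere (0 : ℂ) r) :
    u ∈ unitDisc := by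
  rw [mem_unitDisc]
  simp at hu
  linarith

theorem circleAverage_inv_pow_mul (hQ : DifferentiableOn ℂ Q unitDisc) (hr0 : 0 < r)
    (hr1 : r < 1) (n : ℕ) :
    Real.circleAverage (fun u => u⁻¹ ^ n * Q u) 0 r = taylorCoeff Q n := by
  have h1 : DifferentiableOn ℂ Q (closedBall 0 r) := hQ.mono (closedBall_subset_ball hr1)
  have h2 := h1.circleIntegral_one_div_sub_center_pow_smul hr0 n
  rw [Real.circleAverage_eq_circleIntegral hr0.ne', taylorCoeff]
  have h3 : (fun u : ℂ => (u - 0)⁻¹ • (u⁻¹ ^ n * Q u))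
      = fun u => (1 / (u - 0) ^ (n + 1)) • Q u := by
    funext u
    simp only [sub_zero, smul_eq_mul, one_div, inv_pow, pow_succ, mul_inv]
    ring
  rw [h3, h2]
  have h4 : (n.factorial : ℂ) ≠ 0 := by exact_mod_cast n.factorial_ne_zero
  have h5 := Complex.two_pi_I_ne_zero
  simp only [smul_eq_mul]
  field_simp

/-- On |u| = r one has u⁻¹ = conj u / r², so the integrand is a constant times the conjugate of uⁿ
Q(u), whose mean is its value at 0. -/
theorem circleAverage_inv_pow_mul_conj (hQ : DifferentiableOn ℂ Q unitDisc) (hr0 : 0 < r)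
    (hr1 : r < 1) {n : ℕ} (hn : n ≠ 0) :
    Real.circleAverage (fun u => u⁻¹ ^ n * (starRingEnd ℂ) (Q u)) 0 r = 0 := by
  have hd : DifferentiableOn ℂ (fun u => u ^ n * Q u) (closedBall 0 r) :=
    ((differentiable_id.pow n).differentiableOn).mul (hQ.mono (closedBall_subset_ball hr1))
  have h1 : Real.circleAverage (fun u => u ^ n * Q u) 0 r = 0 := by
    have hd' : DiffContOnCl ℂ (fun u => u ^ n * Q u) (ball 0 |r|) := by
      rw [abs_of_pos hr0]
      exact (hd.mono closure_ball_subset_closedBall).diffContOnCl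
    rw [hd'.circleAverage]
    simp [hn]
  have hint : CircleIntegrable (fun u => u ^ n * Q u) 0 r :=
    (hd.continuousOn.mono sphere_subset_closedBall).circleIntegrable hr0.le
  have h2 := (Complex.conjCLE : ℂ →L[ℝ] ℂ).circleAverage_comp_comm hint
  rw [h1] at h2
  have h3 : Set.EqOn (fun u => u⁻¹ ^ n * (starRingEnd ℂ) (Q u))
      (fun u => ((r ^ 2)⁻¹ ^ n : ℝ) •
        ((Complex.conjCLE : ℂ →L[ℝ] ℂ) ∘ fun u => u ^ n * Q u) u) (sphere 0 |r|) := by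
    intro u hu
    have hu' : ‖u‖ = r := by simpa [abs_of_pos hr0] using hu
    have h4 : u⁻¹ = (starRingEnd ℂ) u * ((r ^ 2)⁻¹ : ℝ) := by
      rw [Complex.inv_def, Complex.normSq_eq_norm_sq, hu']
    simp only [h4, Function.comp_apply, Complex.real_smul, ContinuousLinearEquiv.coe_coe,
      Complex.conjCLE_apply, map_mul, map_pow, mul_pow]
    push_cast
    ring
  rw [Real.circleAverage_congr_sphere h3, Real.circleAverage_fun_smul, h2]
  simp

theorem continuousOn_inv_pow_sphere (hr0 : 0 < r) (n : ℕ) :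
    ContinuousOn (fun u : ℂ => u⁻¹ ^ n) (sphere 0 r) := by
  refine ContinuousOn.pow (continuousOn_id.inv₀ fun u hu => ?_) n
  rintro rfl
  simp at hu
  exact hr0.ne hu

theorem continuousOn_sphere (hQ : DifferentiableOn ℂ Q unitDisc) (hr1 : r < 1) :
    ContinuousOn Q (sphere 0 r) :=
  hQ.continuousOn.mono fun _ hu => mem_unitDisc_of_mem_sphere hr1 hu

/-- Only the holomorphic half of Re Q = (Q + conj Q) / 2 contributes for n ≠ 0, whence the factor
1/2. -/
theorem circleAverage_inv_pow_mul_re (hQ : DifferentiableOn ℂ Q unitDisc) (hr0 : 0 < r)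
    (hr1 : r < 1) {n : ℕ} (hn : n ≠ 0) :
    Real.circleAverage (fun u => u⁻¹ ^ n * ((Q u).re : ℂ)) 0 r = taylorCoeff Q n / 2 := by
  have hc1 : ContinuousOn (fun u => u⁻¹ ^ n * Q u) (sphere 0 r) :=
    (continuousOn_inv_pow_sphere hr0 n).mul (continuousOn_sphere hQ hr1)
  have hc2 : ContinuousOn (fun u => u⁻¹ ^ n * (starRingEnd ℂ) (Q u)) (sphere 0 r) := (continuousOn_inv_pow_sphere hr0 n).mul
    (Complex.continuous_conj.comp_continuousOn (continuousOn_sphere hQ hr1))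
  have h1 : (fun u => u⁻¹ ^ n * ((Q u).re : ℂ)) = fun u => (1 / 2 : ℝ) •
      ((u⁻¹ ^ n * Q u) + (u⁻¹ ^ n * (starRingEnd ℂ) (Q u))) := by
    funext u
    rw [Complex.re_eq_add_conj, Complex.real_smul]
    push_cast
    ring
  rw [h1, Real.circleAverage_fun_smul, Real.circleAverage_fun_add (hc1.circleIntegrable hr0.le)
    (hc2.circleIntegrable hr0.le), circleAverage_inv_pow_mul hQ hr0 hr1,
    circleAverage_inv_pow_mul_conj hQ hr0 hr1 hn, add_zero, Complex.real_smul]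
  push_cast
  ring

theorem circleAverage_re (hQ : DifferentiableOn ℂ Q unitDisc) (hr0 : 0 < r) (hr1 : r < 1) :
    Real.circleAverage (fun u => (Q u).re) 0 r = (Q 0).re := by
  have h1 := circleAverage_inv_pow_mul hQ hr0 hr1 0
  simp only [pow_zero, one_mul, taylorCoeff_zero] at h1
  have h2 := Complex.reCLM.circleAverage_comp_comm
    ((continuousOn_sphere hQ hr1).circleIntegrable hr0.le)
  rw [h1] at h2
  exact h2

/-- The Hadamard product with a function vanishing at the origin as a circle average. -/
theorem circleAverage_powerSum_mul_re {c : ℕ → ℂ} (hc : DiscSummable c) (hc0 : c 0 = 0)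
    (hQ : DifferentiableOn ℂ Q unitDisc) (hr0 : 0 < r) (hr1 : r < 1) {z : ℂ} (hz : ‖z‖ < r) :
    Real.circleAverage (fun u => powerSum c (z * u⁻¹) * ((Q u).re : ℂ)) 0 r
      = powerSum (fun n => c n * taylorCoeff Q n) z / 2 := by
  have hQc := continuousOn_sphere hQ hr1
  have hmap : ∀ θ : ℝ, circleMap 0 r θ ∈ sphere (0 : ℂ) r := fun θ =>
    circleMap_mem_sphere 0 hr0.le θ
  have hQm : Continuous fun θ : ℝ => Q (circleMap 0 r θ) :=
    hQc.comp_continuous (continuous_circleMap 0 r) hmap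
  obtain ⟨M, hM⟩ := (isCompact_sphere (0 : ℂ) r).exists_bound_of_continuousOn hQc
  have hnorm : ∀ θ : ℝ, ‖z * (circleMap 0 r θ)⁻¹‖ = ‖z‖ / r := by
    intro θ
    rw [norm_mul, norm_inv, norm_circleMap_zero, abs_of_pos hr0, div_eq_mul_inv]
  have hq1 : ‖z‖ / r < 1 := (div_lt_one hr0).2 hz
  have hsum := hc (‖z‖ / r) (by positivity) hq1
  have key := intervalIntegral.hasSum_integral_of_dominated_convergence
    (μ := MeasureTheory.volume) (a := 0) (b := 2 * Real.pi)
    (F := fun n θ => c n * (z * (circleMap 0 r θ)⁻¹) ^ n * ((Q (circleMap 0 r θ)).re : ℂ))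
    (f := fun θ => powerSum c (z * (circleMap 0 r θ)⁻¹) * ((Q (circleMap 0 r θ)).re : ℂ))
    (fun n _ => ‖c n‖ * (‖z‖ / r) ^ n * M) ?_ ?_ ?_ ?_ ?_
  · have h2 : (fun n => ∫ θ in (0 : ℝ)..2 * Real.pi,
        c n * (z * (circleMap 0 r θ)⁻¹) ^ n * ((Q (circleMap 0 r θ)).re : ℂ))
        = fun n => (2 * Real.pi : ℝ) • (c n * taylorCoeff Q n * z ^ n / 2) := by
      funext n
      have h3 : (∫ θ in (0 : ℝ)..2 * Real.pi,
          c n * (z * (circleMap 0 r θ)⁻¹) ^ n * ((Q (circleMap 0 r θ)).re : ℂ))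
          = c n * z ^ n * ∫ θ in (0 : ℝ)..2 * Real.pi,
            (circleMap 0 r θ)⁻¹ ^ n * ((Q (circleMap 0 r θ)).re : ℂ) := by
        rw [← intervalIntegral.integral_const_mul]
        refine intervalIntegral.integral_congr fun θ _ => ?_
        simp only [mul_pow]
        ring
      rw [h3]
      rcases eq_or_ne n 0 with rfl | hn
      -- The coefficient formula for the real part fails at n = 0; this is where `c 0 = 0` is
      -- needed.
      · simp [hc0]
      · have h4 := circleAverage_inv_pow_mul_re hQ hr0 hr1 hn
        rw [Real.circleAverage_def, inv_smul_eq_iff₀ Real.two_pi_pos.ne'] at h4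
        rw [h4]
        simp only [Complex.real_smul]
        ring
    rw [h2] at key
    rw [Real.circleAverage_def, inv_smul_eq_iff₀ Real.two_pi_pos.ne', ← key.tsum_eq,
      tsum_const_smul'', tsum_div_const, powerSum]
  · intro n
    refine Continuous.aestronglyMeasurable ?_
    have : Continuous fun θ : ℝ => (circleMap 0 r θ)⁻¹ :=
      (continuous_circleMap 0 r).inv₀ fun θ => circleMap_ne_center hr0.ne'
    exact (continuous_const.mul ((continuous_const.mul this).pow n)).mul
      (Complex.continuous_ofReal.comp (Complex.continuous_re.comp hQm))
  · intro n
    refine MeasureTheory.ae_of_all _ fun θ _ => ?_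
    rw [norm_mul, norm_mul, norm_pow, hnorm]
    gcongr
    rw [Complex.norm_real]
    exact (Complex.abs_re_le_norm _).trans (hM _ (hmap θ))
  · exact MeasureTheory.ae_of_all _ fun θ _ => hsum.mul_right M
  · exact intervalIntegrable_const
  · refine MeasureTheory.ae_of_all _ fun θ _ => ?_
    exact (hc.hasSum (by rw [hnorm]; exact hq1)).mul_right _

end CircleAverage

/-- If the real part of `∑ cₙ zⁿ` is at least `-1 / (2 (1 - β))`, the convolution of `1 + ∑ cₙ zⁿ`
with a function whose values lie in a half plane bounded by a line through `β` has no zeros. -/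
theorem one_add_powerSum_mul_taylorCoeff_ne_zero {c : ℕ → ℂ} (hc : DiscSummable c)
    (hc0 : c 0 = 0) {β φ : ℝ} (hβ : β < 1)
    (hre : ∀ z : ℂ, ‖z‖ < 1 → -(1 / (2 * (1 - β))) ≤ (powerSum c z).re)
    {p : ℂ → ℂ} (hp : DifferentiableOn ℂ p unitDisc) (hp0 : p 0 = 1)
    (hφ : ∀ z ∈ unitDisc, 0 < (Complex.exp (Complex.I * (φ : ℂ)) * (p z - (β : ℂ))).re)
    {z : ℂ} (hz : ‖z‖ < 1) :
    1 + powerSum (fun n => c n * taylorCoeff p n) z ≠ 0 := by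
  have hβ' : 0 < 1 - β := by linarith
  set E := Complex.exp (Complex.I * (φ : ℂ)) with hE
  have hcp : DiscSummable fun n => c n * taylorCoeff p n :=
    hc.mul (discSummable_taylorCoeff hp)
  -- The half-plane condition at the origin reads Re(E (1 - β)) > 0.
  have hE0 : 0 < E.re := by
    have h1 := hφ 0 zero_mem_unitDisc
    rw [hp0, show (1 : ℂ) - β = ((1 - β : ℝ) : ℂ) by push_cast; ring, Complex.re_mul_ofReal] at h1
    exact pos_of_mul_pos_left h1 hβ'.le
  set Q : ℂ → ℂ := fun z => E * (p z - β) with hQ_def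
  have hQ : DifferentiableOn ℂ Q unitDisc := (hp.sub_const _).const_mul _
  have hQc : ∀ n, n ≠ 0 → taylorCoeff Q n = E * taylorCoeff p n := by
    intro n hn
    have h1 : taylorCoeff Q n = E * taylorCoeff (fun z => p z - β) n := by
      simp only [taylorCoeff, hQ_def]
      rw [iteratedDeriv_const_mul_field]
      ring
    rw [h1]
    obtain ⟨m, rfl⟩ := Nat.exists_eq_succ_of_ne_zero hn
    simp only [taylorCoeff, Nat.succ_eq_add_one, iteratedDeriv_succ', deriv_sub_const_fun]
  set X : ℂ → ℂ := fun z => E * (1 + powerSum (fun n => c n * taylorCoeff p n) z) with hX_def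
  have hX : DifferentiableOn ℂ X unitDisc := (hcp.differentiableOn.const_add _).const_mul _
  have hX0 : 0 < (X 0).re := by
    simpa [hX_def, powerSum_zero, hc0] using hE0
  have hXre : ∀ z ∈ unitDisc, 0 ≤ (X z).re := by
    intro z hz
    obtain ⟨r, hzr, hr1⟩ := exists_between (mem_unitDisc.1 hz)
    have hr0 : 0 < r := (norm_nonneg z).trans_lt hzr
    have h1 := circleAverage_powerSum_mul_re hc hc0 hQ hr0 hr1 hzr
    have h2 : powerSum (fun n => c n * taylorCoeff Q n) z
        = E * powerSum (fun n => c n * taylorCoeff p n) z := by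
      rw [← powerSum_const_mul]
      congr 1
      funext n
      rcases eq_or_ne n 0 with rfl | hn
      · simp [hc0]
      · rw [hQc n hn]
        ring
    have hmem : ∀ u ∈ sphere (0 : ℂ) r, ‖z * u⁻¹‖ < 1 := by
      intro u hu
      have hu' : ‖u‖ = r := by simpa using hu
      rw [norm_mul, norm_inv, hu', ← div_eq_mul_inv]
      exact (div_lt_one hr0).2 hzr
    have hQs := continuousOn_sphere hQ hr1
    have hinv : ContinuousOn (fun u : ℂ => u⁻¹) (sphere 0 r) := by
      simpa using continuousOn_inv_pow_sphere hr0 1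
    have hCs : ContinuousOn (fun u => powerSum c (z * u⁻¹)) (sphere 0 r) :=
      hc.differentiableOn.continuousOn.comp (continuousOn_const.mul hinv)
        fun u hu => mem_unitDisc.2 (hmem u hu)
    have hQre : ContinuousOn (fun u => (Q u).re) (sphere 0 r) :=
      Complex.continuous_re.comp_continuousOn hQs
    have hint : CircleIntegrable (fun u => powerSum c (z * u⁻¹) * ((Q u).re : ℂ)) 0 r :=
      (hCs.mul (Complex.continuous_ofReal.comp_continuousOn hQre)).circleIntegrable hr0.le
    have h3 := Complex.reCLM.circleAverage_comp_comm hint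
    rw [h1] at h3
    -- The lower bound on Re c is integrated against the positive weight Re Q, of mean (1 - β) Re E.
    -- Hence Re(E (c * p)) ≥ -Re E, which is exactly Re X ≥ 0.
    have h4 : Real.circleAverage (fun u => -(1 / (2 * (1 - β))) • (Q u).re) 0 r
        ≤ Real.circleAverage
          (Complex.reCLM ∘ fun u => powerSum c (z * u⁻¹) * ((Q u).re : ℂ)) 0 r := by
      refine Real.circleAverage_mono ?_ ?_ ?_
      · exact ContinuousOn.circleIntegrable hr0.le (hQre.const_smul (-(1 / (2 * (1 - β)))))
      · exact (Complex.continuous_re.comp_continuousOn (hCs.mul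
          (Complex.continuous_ofReal.comp_continuousOn hQre))).circleIntegrable hr0.le
      · intro u hu
        rw [abs_of_pos hr0] at hu
        simp only [Function.comp_apply, Complex.reCLM_apply, Complex.re_mul_ofReal, smul_eq_mul]
        exact mul_le_mul_of_nonneg_right (hre _ (hmem u hu))
          (hφ u (mem_unitDisc_of_mem_sphere hr1 hu)).le
    rw [Real.circleAverage_fun_smul, circleAverage_re hQ hr0 hr1, h3, h2] at h4
    have h5 : (Q 0).re = E.re * (1 - β) := by
      simp only [hQ_def, hp0]
      rw [show (1 : ℂ) - β = ((1 - β : ℝ) : ℂ) by push_cast; ring, Complex.re_mul_ofReal]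
    rw [h5] at h4
    have h6 : -(1 / (2 * (1 - β))) • (E.re * (1 - β)) = -(E.re / 2) := by
      rw [smul_eq_mul]
      field_simp
    rw [h6] at h4
    simp only [Complex.reCLM_apply] at h4
    have h7 : (E * powerSum (fun n => c n * taylorCoeff p n) z / 2).re
        = (E * powerSum (fun n => c n * taylorCoeff p n) z).re / 2 := by
      rw [show (2 : ℂ) = ((2 : ℝ) : ℂ) by norm_num, Complex.div_ofReal_re]
    rw [h7] at h4
    simp only [hX_def, mul_add, mul_one, Complex.add_re]
    linarith
  have h1 := ne_zero_of_re_nonneg hX hXre hX0 (mem_unitDisc.2 hz)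
  exact right_ne_zero_of_mul h1

/-- Conversely, if the real part of `∑ cₙ zⁿ` takes a value below `-1 / (2 (1 - β))`, some function
`1 + (1 - β) (1 + η) z / (1 - z)` violates the conclusion. -/
theorem exists_one_add_mul_powerSum_eq_zero {c : ℕ → ℂ} (hc : DiscSummable c)
    (hc0 : c 0 = 0) {β : ℝ} (hβ : β < 1) {z₀ : ℂ} (hz₀ : ‖z₀‖ < 1)
    (hre : (powerSum c z₀).re < -(1 / (2 * (1 - β)))) :
    ∃ (η : ℂ) (φ : ℝ) (z : ℂ), ‖z‖ < 1 ∧ 1 + (1 - β) * (1 + η) * powerSum c z = 0 ∧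
      ∀ w ∈ unitDisc, 0 < (Complex.exp (Complex.I * (φ : ℂ)) *
        (1 + (1 - β) * (1 + η) * (w / (1 - w)) - (β : ℂ))).re := by
  have hβ' : 0 < 1 - β := by linarith
  have hcont : ContinuousOn (fun w => (powerSum c w).re) unitDisc :=
    Complex.continuous_re.comp_continuousOn hc.differentiableOn.continuousOn
  have hmem : -(1 / (2 * (1 - β))) ∈ Set.Icc (powerSum c z₀).re (powerSum c 0).re := by
    refine ⟨hre.le, ?_⟩
    rw [powerSum_zero, hc0, Complex.zero_re, neg_nonpos]
    positivity
  -- The real part is 0 at the origin and too small at `z₀`, so it takes the critical value exactly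
  -- somewhere.
  obtain ⟨z, hz, hzre⟩ := isPreconnected_unitDisc.intermediate_value (mem_unitDisc.2 hz₀)
    zero_mem_unitDisc hcont hmem
  simp only at hzre
  set C := powerSum c z with hC
  -- At the critical value Re v = 1/2, that is |1 - v| = |v|; hence η = 1/v - 1 is unimodular, and 1
  -- + (1 - β)(1 + η) C = 1 - v⁻¹ v = 0.
  set v : ℂ := -((1 - β : ℝ) * C) with hv
  have hvre : v.re = 1 / 2 := by
    rw [hv, Complex.neg_re, Complex.re_ofReal_mul, hzre]
    field_simp
  have hv0 : v ≠ 0 := by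
    intro h
    rw [h] at hvre
    norm_num at hvre
  have hη : ‖v⁻¹ - 1‖ = 1 := by
    have h1 : ‖1 - v‖ = ‖v‖ := by
      rw [← sq_eq_sq₀ (norm_nonneg _) (norm_nonneg _), ← Complex.normSq_eq_norm_sq,
        ← Complex.normSq_eq_norm_sq, Complex.normSq_apply, Complex.normSq_apply]
      simp [hvre]
      norm_num
    rw [show v⁻¹ - 1 = (1 - v) / v by field_simp, norm_div, h1,
      div_self (norm_ne_zero_iff.2 hv0)]
  set η : ℂ := v⁻¹ - 1 with hη_def
  -- Half the argument: e^{-is}(1 + η) = 2 cos s is real, and it is positive because η ≠ -1. So φ =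
  -- -s is the rotation that works.
  set s : ℝ := Complex.arg η / 2 with hs
  have hηexp : η = Complex.exp (Complex.I * s) * Complex.exp (Complex.I * s) := by
    have h1 := Complex.norm_mul_exp_arg_mul_I η
    rw [hη, Complex.ofReal_one, one_mul] at h1
    rw [← Complex.exp_add, hs]
    nth_rewrite 1 [← h1]
    congr 1
    push_cast
    ring
  have hcos : 0 < Real.cos s := by
    have hne : η ≠ -1 := by
      intro h
      have h1 : v⁻¹ = 0 := by linear_combination h
      exact hv0 (inv_eq_zero.1 h1)
    have hpi : Complex.arg η ≠ Real.pi := by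
      intro h
      have h1 := Complex.norm_mul_exp_arg_mul_I η
      rw [hη, Complex.ofReal_one, one_mul, h, Complex.exp_pi_mul_I] at h1
      exact hne h1.symm
    have h1 := Complex.neg_pi_lt_arg η
    have h2 := lt_of_le_of_ne (Complex.arg_le_pi η) hpi
    exact Real.cos_pos_of_mem_Ioo ⟨by rw [hs]; linarith, by rw [hs]; linarith⟩
  refine ⟨η, -s, z, mem_unitDisc.1 hz, ?_, ?_⟩
  · have h1 : 1 + η = v⁻¹ := by rw [hη_def]; ring
    rw [h1]
    have h2 : (1 - β : ℂ) * C = -v := by rw [hv]; push_cast; ring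
    rw [mul_right_comm, h2, neg_mul, mul_inv_cancel₀ hv0]
    ring
  · intro w hw
    have hw1 := mem_unitDisc.1 hw
    have hw0 : 1 - w ≠ 0 := by
      intro h
      rw [← sub_eq_zero.1 h] at hw1
      simp at hw1
    have hexp : Complex.exp (Complex.I * ((-s : ℝ) : ℂ)) * Complex.exp (Complex.I * s) = 1 := by
      rw [← Complex.exp_add]
      push_cast
      simp
    have h2cos : Complex.exp (Complex.I * ((-s : ℝ) : ℂ)) + Complex.exp (Complex.I * s)
        = ((2 * Real.cos s : ℝ) : ℂ) := by
      push_cast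
      rw [Complex.two_cos, add_comm]
      congr 2 <;> ring
    have hval : Complex.exp (Complex.I * ((-s : ℝ) : ℂ)) *
        (1 + (1 - β) * (1 + η) * (w / (1 - w)) - (β : ℂ))
        = ((1 - β : ℝ) : ℂ) * (Complex.exp (Complex.I * ((-s : ℝ) : ℂ))
          + ((2 * Real.cos s : ℝ) : ℂ) * (w / (1 - w))) := by
      rw [← h2cos, hηexp, Complex.ofReal_sub, Complex.ofReal_one]
      linear_combination (1 - β : ℂ) * (w / (1 - w)) * Complex.exp (Complex.I * s) * hexp
    have hre1 : (Complex.exp (Complex.I * ((-s : ℝ) : ℂ))).re = Real.cos s := by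
      rw [mul_comm, Complex.exp_ofReal_mul_I_re, Real.cos_neg]
    rw [hval, Complex.re_ofReal_mul, Complex.add_re, hre1, Complex.re_ofReal_mul]
    -- The quantity is the real part of (1 + w) / (1 - w), which maps the disc to the right half
    -- plane.
    have hpos : 0 < 1 + 2 * (w / (1 - w)).re := by
      have h1 : (1 + 2 * (w / (1 - w))) = (1 + w) * (starRingEnd ℂ) (1 - w)
          * ((Complex.normSq (1 - w))⁻¹ : ℝ) := by
        rw [mul_assoc, ← Complex.inv_def]
        field_simp
        ring
      have h2 := congrArg Complex.re h1
      rw [Complex.re_mul_ofReal] at h2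
      have h3 : ((1 + w) * (starRingEnd ℂ) (1 - w)).re = 1 - Complex.normSq w := by
        simp [Complex.normSq_apply]
        ring
      have h4 : Complex.normSq w < 1 := by
        rw [Complex.normSq_eq_norm_sq]
        exact pow_lt_one₀ (norm_nonneg _) hw1 two_ne_zero
      have h5 : (1 + 2 * (w / (1 - w))).re = 1 + 2 * (w / (1 - w)).re := by simp
      rw [← h5, h2, h3]
      exact mul_pos (by linarith) (inv_pos.2 (Complex.normSq_pos.2 hw0))
    have : Real.cos s + 2 * Real.cos s * (w / (1 - w)).re
        = Real.cos s * (1 + 2 * (w / (1 - w)).re) := by ring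
    rw [this]
    positivity

end Pascu

end

/-! ### Moments and iterated tail integrals. -/

noncomputable section

namespace Pascu

open MeasureTheory Set

/-- The `n`-th moment of a density on the unit interval. -/
def moment (φ : ℝ → ℝ) (n : ℕ) : ℝ := ∫ t in (0 : ℝ)..1, φ t * t ^ n

/-- The density `t ^ (a - 1) ∫_t^1 φ(x) x ^ (-a) dx`, whose `n`-th moment is the `n`-th moment of
`φ` divided by `n + a`. -/
def weightedTail (a : ℝ) (φ : ℝ → ℝ) (t : ℝ) : ℝ := t ^ (a - 1) * ∫ x in t..1, φ x / x ^ a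

theorem intervalIntegral_eq_integral_Ioo {E : Type*} [NormedAddCommGroup E] [NormedSpace ℝ E]
    (f : ℝ → E) : ∫ t in (0 : ℝ)..1, f t = ∫ t in Ioo (0 : ℝ) 1, f t := by
  rw [intervalIntegral.integral_of_le zero_le_one, integral_Ioc_eq_integral_Ioo]

theorem intervalIntegrable_iff_Ioo {E : Type*} [NormedAddCommGroup E] {f : ℝ → E} :
    IntervalIntegrable f volume 0 1 ↔ IntegrableOn f (Ioo 0 1) := by
  rw [intervalIntegrable_iff_integrableOn_Ioo_of_le zero_le_one]

/-- Dominated convergence with majorants ‖b n‖ |φ|. In applications `b` carries a factor zⁿ with |z|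
< 1, which provides the absolute summability. -/
theorem hasSum_mul_moment {φ : ℝ → ℝ} (hφ : IntervalIntegrable φ volume 0 1) {b : ℕ → ℂ}
    (hb : Summable fun n => ‖b n‖) :
    HasSum (fun n => b n * (moment φ n : ℂ))
      (∫ t in (0 : ℝ)..1, (φ t : ℂ) * powerSum b (t : ℂ)) := by
  have h1 : ∀ n, b n * (moment φ n : ℂ)
      = ∫ t in (0 : ℝ)..1, (φ t : ℂ) * (b n * (t : ℂ) ^ n) := by
    intro n
    rw [moment, ← intervalIntegral.integral_ofReal, ← intervalIntegral.integral_const_mul]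
    refine intervalIntegral.integral_congr fun t _ => ?_
    push_cast
    ring
  simp only [h1]
  have hle : ∀ n : ℕ, ∀ t : ℝ, t ∈ uIoc (0 : ℝ) 1 → ‖b n * (t : ℂ) ^ n‖ ≤ ‖b n‖ := by
    intro n t ht
    rw [uIoc_of_le zero_le_one] at ht
    rw [norm_mul, norm_pow, Complex.norm_real, Real.norm_of_nonneg ht.1.le]
    exact mul_le_of_le_one_right (norm_nonneg _) (pow_le_one₀ ht.1.le ht.2)
  refine intervalIntegral.hasSum_integral_of_dominated_convergence
    (fun n t => ‖b n‖ * |φ t|) ?_ ?_ ?_ ?_ ?_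
  · intro n
    have h2 : AEStronglyMeasurable (fun t => (φ t : ℂ)) (volume.restrict (uIoc 0 1)) :=
      Complex.continuous_ofReal.comp_aestronglyMeasurable hφ.aestronglyMeasurable_restrict_uIoc
    exact h2.mul (by fun_prop : Continuous fun t : ℝ => b n * (t : ℂ) ^ n).aestronglyMeasurable
  · intro n
    refine ae_of_all _ fun t ht => ?_
    rw [norm_mul, mul_comm, Complex.norm_real, Real.norm_eq_abs]
    exact mul_le_mul_of_nonneg_right (hle n t ht) (abs_nonneg _)
  · exact ae_of_all _ fun t _ => hb.mul_right _
  · simp only [tsum_mul_right]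
    exact (hφ.abs).const_mul _
  · refine ae_of_all _ fun t ht => ?_
    have h3 : Summable fun n => b n * (t : ℂ) ^ n :=
      Summable.of_norm_bounded hb fun n => hle n t ht
    exact h3.hasSum.mul_left _

section Fubini

variable {a : ℝ} {φ : ℝ → ℝ}

theorem intervalIntegrable_rpow_sub_one (ha : 0 < a) (x y : ℝ) :
    IntervalIntegrable (fun t : ℝ => t ^ (a - 1)) volume x y :=
  intervalIntegral.intervalIntegrable_rpow' (by linarith)

/-- The integrand on the triangle `0 < t < x < 1`. -/
def triangleKernel (a : ℝ) (φ : ℝ → ℝ) (k : ℝ → ℂ) (p : ℝ × ℝ) : ℂ :=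
  {p : ℝ × ℝ | p.1 < p.2}.indicator
    (fun p => ((φ p.2 / p.2 ^ a : ℝ) : ℂ) * (((p.1 ^ (a - 1) : ℝ) : ℂ) * k p.1)) p

theorem measurableSet_triangle : MeasurableSet {p : ℝ × ℝ | p.1 < p.2} :=
  measurableSet_lt measurable_fst measurable_snd

theorem integral_triangleKernel_left {k : ℝ → ℂ} {t : ℝ} (ht : t ∈ Ioo (0 : ℝ) 1) :
    ∫ x in Ioo (0 : ℝ) 1, triangleKernel a φ k (t, x) = (weightedTail a φ t : ℂ) * k t := by
  have h1 : (fun x => triangleKernel a φ k (t, x)) = (Ioi t).indicator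
      fun x => ((φ x / x ^ a : ℝ) : ℂ) * (((t ^ (a - 1) : ℝ) : ℂ) * k t) := by
    funext x
    by_cases hx : t < x <;> simp [triangleKernel, hx]
  rw [h1, setIntegral_indicator measurableSet_Ioi]
  have h2 : Ioo (0 : ℝ) 1 ∩ Ioi t = Ioo t 1 := by
    ext x
    simp only [mem_inter_iff, mem_Ioo, mem_Ioi]
    have := ht.1
    constructor
    · rintro ⟨⟨_, h⟩, h'⟩
      exact ⟨h', h⟩
    · rintro ⟨h, h'⟩
      exact ⟨⟨by linarith, h'⟩, h⟩
  rw [h2, integral_mul_const, weightedTail, intervalIntegral.integral_of_le ht.2.le,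
    integral_Ioc_eq_integral_Ioo, integral_complex_ofReal]
  push_cast
  ring

theorem integral_triangleKernel_right {k : ℝ → ℂ} {x : ℝ} (hx : x ∈ Ioo (0 : ℝ) 1) :
    ∫ t in Ioo (0 : ℝ) 1, triangleKernel a φ k (t, x)
      = (φ x : ℂ) * ∫ s in (0 : ℝ)..1, ((s ^ (a - 1) : ℝ) : ℂ) * k (x * s) := by
  have h1 : (fun t => triangleKernel a φ k (t, x)) = (Iio x).indicator
      fun t => ((φ x / x ^ a : ℝ) : ℂ) * (((t ^ (a - 1) : ℝ) : ℂ) * k t) := by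
    funext t
    by_cases hx : t < x <;> simp [triangleKernel, hx]
  rw [h1, setIntegral_indicator measurableSet_Iio]
  have h2 : Ioo (0 : ℝ) 1 ∩ Iio x = Ioo 0 x := by
    ext t
    simp only [mem_inter_iff, mem_Ioo, mem_Iio]
    have := hx.2
    constructor
    · rintro ⟨⟨h, _⟩, h'⟩
      exact ⟨h, h'⟩
    · rintro ⟨h, h'⟩
      exact ⟨⟨h, by linarith⟩, h'⟩
  rw [h2, integral_const_mul, ← integral_Ioc_eq_integral_Ioo,
    ← intervalIntegral.integral_of_le hx.1.le]
  -- Substituting t = x s produces x · x ^ (a - 1) = x ^ a, which cancels the singular factor of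
  -- φ(x) / x ^ a.
  have h3 := intervalIntegral.smul_integral_comp_mul_left
    (f := fun t => ((t ^ (a - 1) : ℝ) : ℂ) * k t) (a := 0) (b := 1) x
  rw [mul_zero, mul_one] at h3
  have h4 : ∫ s in (0 : ℝ)..1, (((x * s) ^ (a - 1) : ℝ) : ℂ) * k (x * s)
      = ((x ^ (a - 1) : ℝ) : ℂ) * ∫ s in (0 : ℝ)..1, ((s ^ (a - 1) : ℝ) : ℂ) * k (x * s) := by
    rw [← intervalIntegral.integral_const_mul]
    refine intervalIntegral.integral_congr fun s hs => ?_
    rw [uIcc_of_le zero_le_one] at hs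
    simp only [Real.mul_rpow hx.1.le hs.1]
    push_cast
    ring
  rw [← h3, h4, Complex.real_smul, ← mul_assoc, ← mul_assoc, ← Complex.ofReal_mul,
    ← Complex.ofReal_mul]
  congr 2
  have h5 : x ^ a = x * x ^ (a - 1) := by
    rw [Real.rpow_sub_one hx.1.ne', mul_div_cancel₀ _ hx.1.ne']
  have h6 : x ^ a ≠ 0 := (Real.rpow_pos_of_pos hx.1 a).ne'
  rw [mul_assoc, ← h5, div_mul_cancel₀ _ h6]

theorem integrable_triangleKernel (ha : 0 < a) (hφ : IntervalIntegrable φ volume 0 1)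
    {k : ℝ → ℂ} (hk : ContinuousOn k (Ioo 0 1)) {M : ℝ} (hM : ∀ t ∈ Ioo (0 : ℝ) 1, ‖k t‖ ≤ M) :
    Integrable (triangleKernel a φ k)
      ((volume.restrict (Ioo 0 1)).prod (volume.restrict (Ioo 0 1))) := by
  set m := volume.restrict (Ioo (0 : ℝ) 1) with hm
  have hφ' := intervalIntegrable_iff_Ioo.1 hφ
  have hmeas : ∀ {k : ℝ → ℂ}, ContinuousOn k (Ioo 0 1) →
      AEStronglyMeasurable (triangleKernel a φ k) (m.prod m) := by
    intro k hk
    refine AEStronglyMeasurable.indicator ?_ measurableSet_triangle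
    have h1 : AEStronglyMeasurable (fun x : ℝ => φ x / x ^ a) m :=
      hφ'.aestronglyMeasurable.div₀
        (Measurable.aestronglyMeasurable (by fun_prop))
    have h2 : AEStronglyMeasurable (fun t : ℝ => ((t ^ (a - 1) : ℝ) : ℂ)) m :=
      Measurable.aestronglyMeasurable (by fun_prop)
    have h3 : AEStronglyMeasurable k m := hk.aestronglyMeasurable measurableSet_Ioo
    have h4 : AEStronglyMeasurable (fun x : ℝ => ((φ x / x ^ a : ℝ) : ℂ)) m :=
      Complex.continuous_ofReal.comp_aestronglyMeasurable h1
    exact h4.comp_snd.mul (h2.mul h3).comp_fst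
  -- For k = 1 the inner integral of t ^ (a - 1) over (0, x) is x ^ a / a, so the norm integrates in
  -- t to |φ(x)| / a. A bounded k is then dominated by this case.
  have hone : Integrable (triangleKernel a φ fun _ => 1) (m.prod m) := by
    rw [integrable_prod_iff' (hmeas continuousOn_const)]
    constructor
    · refine (ae_restrict_mem measurableSet_Ioo).mono fun x hx => ?_
      have h1 : (fun t => triangleKernel a φ (fun _ => 1) (t, x)) = (Iio x).indicator
          fun t => ((φ x / x ^ a : ℝ) : ℂ) * (((t ^ (a - 1) : ℝ) : ℂ) * 1) := by
        funext t
        by_cases hx : t < x <;> simp [triangleKernel, hx]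
      rw [h1]
      refine Integrable.indicator ?_ measurableSet_Iio
      have h2 := intervalIntegrable_iff_Ioo.1 (intervalIntegrable_rpow_sub_one ha 0 1)
      exact (h2.ofReal.mul_const 1).const_mul _
    · have h1 : ∀ x ∈ Ioo (0 : ℝ) 1,
          ∫ t, ‖triangleKernel a φ (fun _ => 1) (t, x)‖ ∂m = |φ x| * a⁻¹ := by
        intro x hx
        have h2 : ∀ t ∈ Ioo (0 : ℝ) 1, ((‖triangleKernel a φ (fun _ => 1) (t, x)‖ : ℝ) : ℂ)
            = triangleKernel a (fun x => |φ x|) (fun _ => 1) (t, x) := by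
          intro t ht
          by_cases htx : t < x
          · simp [triangleKernel, htx, abs_of_pos (Real.rpow_pos_of_pos hx.1 a),
              abs_of_pos (Real.rpow_pos_of_pos ht.1 (a - 1))]
          · simp [triangleKernel, htx]
        have h3 := integral_triangleKernel_right (a := a) (φ := fun x => |φ x|)
          (k := fun _ => 1) hx
        rw [← setIntegral_congr_fun measurableSet_Ioo h2, integral_complex_ofReal] at h3
        simp only [mul_one] at h3
        rw [intervalIntegral.integral_ofReal, integral_rpow (Or.inl (by linarith))] at h3
        simp only [sub_add_cancel, Real.one_rpow, Real.zero_rpow ha.ne', sub_zero] at h3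
        rw [← one_div]
        exact_mod_cast h3
      refine Integrable.congr (f := fun x => |φ x| * a⁻¹) (hφ'.abs.mul_const _) ?_
      exact (ae_restrict_mem measurableSet_Ioo).mono fun x hx => (h1 x hx).symm
  refine (hone.norm.const_mul M).mono' (hmeas hk) ?_
  have h1 : ∀ᵐ p ∂(m.prod m), p ∈ Ioo (0 : ℝ) 1 ×ˢ Ioo (0 : ℝ) 1 := by
    rw [hm, Measure.prod_restrict]
    exact ae_restrict_mem (measurableSet_Ioo.prod measurableSet_Ioo)
  refine h1.mono fun p hp => ?_
  by_cases h : p.1 < p.2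
  · simp only [triangleKernel, mem_ofPred_eq, h, indicator_of_mem, norm_mul, mul_one]
    calc _ = ‖k p.1‖ * (‖((φ p.2 / p.2 ^ a : ℝ) : ℂ)‖ * ‖((p.1 ^ (a - 1) : ℝ) : ℂ)‖) := by ring
      _ ≤ _ := by
        gcongr
        exact hM _ hp.1
  · simp [triangleKernel, h]

theorem intervalIntegrable_weightedTail (ha : 0 < a) (hφ : IntervalIntegrable φ volume 0 1) :
    IntervalIntegrable (weightedTail a φ) volume 0 1 := by
  have h1 := (integrable_triangleKernel ha hφ (k := fun _ => 1) continuousOn_const (M := 1)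
    (by simp)).integral_prod_left
  rw [intervalIntegrable_iff_Ioo]
  have h2 : IntegrableOn (fun t => (weightedTail a φ t : ℂ)) (Ioo 0 1) := by
    refine Integrable.congr h1 ?_
    refine (ae_restrict_mem measurableSet_Ioo).mono fun t ht => ?_
    simpa using integral_triangleKernel_left (a := a) (φ := φ) (k := fun _ => 1) ht
  exact h2.re

theorem integral_weightedTail_mul (ha : 0 < a) (hφ : IntervalIntegrable φ volume 0 1)
    {k : ℝ → ℂ} (hk : ContinuousOn k (Ioo 0 1)) {M : ℝ} (hM : ∀ t ∈ Ioo (0 : ℝ) 1, ‖k t‖ ≤ M) :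
    ∫ t in (0 : ℝ)..1, (weightedTail a φ t : ℂ) * k t
      = ∫ x in (0 : ℝ)..1,
          (φ x : ℂ) * ∫ s in (0 : ℝ)..1, ((s ^ (a - 1) : ℝ) : ℂ) * k (x * s) := by
  rw [intervalIntegral_eq_integral_Ioo, intervalIntegral_eq_integral_Ioo,
    ← setIntegral_congr_fun measurableSet_Ioo fun t ht => integral_triangleKernel_left ht,
    ← setIntegral_congr_fun measurableSet_Ioo fun x hx => integral_triangleKernel_right hx]
  exact integral_integral_swap (f := fun t x => triangleKernel a φ k (t, x))
    (integrable_triangleKernel ha hφ hk hM)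

theorem ofReal_mem_unitDisc {t : ℝ} (ht : t ∈ Ioo (0 : ℝ) 1) : ‖(t : ℂ)‖ < 1 := by
  rw [Complex.norm_real, Real.norm_of_nonneg ht.1.le]
  exact ht.2

theorem continuousOn_powerSum_ofReal {b : ℕ → ℂ} (hb : DiscSummable b) :
    ContinuousOn (fun t : ℝ => powerSum b (t : ℂ)) (Ioo 0 1) :=
  hb.differentiableOn.continuousOn.comp Complex.continuous_ofReal.continuousOn
    fun _ ht => mem_unitDisc.2 (ofReal_mem_unitDisc ht)

theorem moment_rpow_sub_one (ha : 0 < a) (n : ℕ) :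
    moment (fun s => s ^ (a - 1)) n = ((n : ℝ) + a)⁻¹ := by
  have hn : (0 : ℝ) ≤ n := n.cast_nonneg
  have h1 : moment (fun s => s ^ (a - 1)) n = ∫ t in (0 : ℝ)..1, t ^ ((n : ℝ) + a - 1) := by
    rw [moment, intervalIntegral_eq_integral_Ioo, intervalIntegral_eq_integral_Ioo]
    refine setIntegral_congr_fun measurableSet_Ioo fun t ht => ?_
    rw [← Real.rpow_natCast, ← Real.rpow_add ht.1]
    congr 1
    ring
  rw [h1, integral_rpow (Or.inl (by linarith))]
  simp [Real.zero_rpow (by linarith : (n : ℝ) + a ≠ 0)]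

theorem integral_rpow_mul_powerSum (ha : 0 < a) {b : ℕ → ℂ} (hb : DiscSummable b) {x : ℝ}
    (hx : x ∈ Ioo (0 : ℝ) 1) :
    ∫ s in (0 : ℝ)..1, ((s ^ (a - 1) : ℝ) : ℂ) * powerSum b ((x * s : ℝ) : ℂ)
      = powerSum (fun n => b n / ((n : ℂ) + a)) (x : ℂ) := by
  have h1 := hasSum_mul_moment (intervalIntegrable_rpow_sub_one ha 0 1)
    (hb.summable_norm (ofReal_mem_unitDisc hx))
  simp only [powerSum_mul_pow, ← Complex.ofReal_mul] at h1
  rw [← h1.tsum_eq, powerSum]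
  refine tsum_congr fun n => ?_
  rw [moment_rpow_sub_one ha]
  push_cast
  ring

theorem DiscSummable.div_add (ha : 0 < a) {b : ℕ → ℂ} (hb : DiscSummable b) :
    DiscSummable fun n => b n / ((n : ℂ) + a) :=
  hb.of_le_const a⁻¹ fun n => by
    have hn : (0 : ℝ) ≤ n := n.cast_nonneg
    have h1 : ‖(n : ℂ) + a‖ = n + a := by
      rw [show (n : ℂ) + a = ((n + a : ℝ) : ℂ) by push_cast; ring, Complex.norm_real,
        Real.norm_of_nonneg (by linarith)]
    rw [norm_div, h1, div_eq_inv_mul]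
    gcongr
    linarith

/-- Dividing the coefficients by n + a averages the function against s ^ (a - 1), of total mass 1/a.
The bound is thus passed on, so that the tail operator can be applied a second time. -/
theorem norm_powerSum_div_add_le (ha : 0 < a) {b : ℕ → ℂ} (hb : DiscSummable b) {M : ℝ}
    (hM : ∀ t ∈ Ioo (0 : ℝ) 1, ‖powerSum b (t : ℂ)‖ ≤ M) {x : ℝ} (hx : x ∈ Ioo (0 : ℝ) 1) :
    ‖powerSum (fun n => b n / ((n : ℂ) + a)) (x : ℂ)‖ ≤ M * a⁻¹ := by
  rw [← integral_rpow_mul_powerSum ha hb hx]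
  have h1 : ∫ s in (0 : ℝ)..1, s ^ (a - 1) * M = M * a⁻¹ := by
    rw [intervalIntegral.integral_mul_const, integral_rpow (Or.inl (by linarith))]
    simp [Real.zero_rpow ha.ne']
    ring
  rw [← h1]
  refine intervalIntegral.norm_integral_le_of_norm_le zero_le_one
    (ae_of_all _ fun s hs => ?_) ((intervalIntegrable_rpow_sub_one ha 0 1).mul_const M)
  rw [norm_mul, Complex.norm_real, Real.norm_of_nonneg (Real.rpow_nonneg hs.1.le _)]
  gcongr
  · exact Real.rpow_nonneg hs.1.le _
  · exact hM _ ⟨mul_pos hx.1 hs.1, by nlinarith [hx.1, hx.2, hs.2]⟩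

/-- Only boundedness on (0, 1) is required, not absolute summability at radius 1: the kernel on the
negative radius is bounded although its coefficients may grow. -/
theorem integral_weightedTail_mul_powerSum (ha : 0 < a) (hφ : IntervalIntegrable φ volume 0 1)
    {b : ℕ → ℂ} (hb : DiscSummable b) {M : ℝ}
    (hM : ∀ t ∈ Ioo (0 : ℝ) 1, ‖powerSum b (t : ℂ)‖ ≤ M) :
    ∫ t in (0 : ℝ)..1, (weightedTail a φ t : ℂ) * powerSum b (t : ℂ)
      = ∫ x in (0 : ℝ)..1, (φ x : ℂ) * powerSum (fun n => b n / ((n : ℂ) + a)) (x : ℂ) := by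
  rw [integral_weightedTail_mul ha hφ (continuousOn_powerSum_ofReal hb) hM,
    intervalIntegral_eq_integral_Ioo, intervalIntegral_eq_integral_Ioo]
  refine setIntegral_congr_fun measurableSet_Ioo fun x hx => ?_
  rw [integral_rpow_mul_powerSum ha hb hx]

/-- Two successive applications of `weightedTail` with the exponents of `bigLambda` and
`bigPi`. -/
theorem integral_bigPi_mul_powerSum {lam : ℝ → ℝ} {μ ν : ℝ} (hμ : 0 < μ) (hν : 0 < ν)
    (hlam : IntervalIntegrable lam volume 0 1) {b : ℕ → ℂ} (hb : DiscSummable b) {M : ℝ}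
    (hM : ∀ t ∈ Ioo (0 : ℝ) 1, ‖powerSum b (t : ℂ)‖ ≤ M) :
    IntervalIntegrable (fun t => t ^ (1 / μ - 1) * bigPi lam μ ν t) volume 0 1 ∧
    (IntervalIntegrable (fun x => (lam x : ℂ) *
      powerSum (fun n => b n / ((1 + μ * n) * (1 + ν * n))) (x : ℂ)) volume 0 1) ∧
    ∫ t in (0 : ℝ)..1, ((t ^ (1 / μ - 1) * bigPi lam μ ν t : ℝ) : ℂ) * powerSum b (t : ℂ)
      = μ * ν * ∫ x in (0 : ℝ)..1, (lam x : ℂ) *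
          powerSum (fun n => b n / ((1 + μ * n) * (1 + ν * n))) (x : ℂ) := by
  have hμ' : 0 < 1 / μ := by positivity
  have hν' : 0 < 1 / ν := by positivity
  have h1 := intervalIntegrable_weightedTail hν' hlam
  have h2 := intervalIntegrable_weightedTail hμ' h1
  have h3 : ∀ t ∈ Ioo (0 : ℝ) 1, weightedTail (1 / μ) (weightedTail (1 / ν) lam) t
      = t ^ (1 / μ - 1) * bigPi lam μ ν t := by
    intro t ht
    rw [weightedTail, bigPi]
    congr 1
    refine intervalIntegral.integral_congr fun x hx => ?_
    rw [uIcc_of_le ht.2.le] at hx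
    have hx0 : 0 < x := ht.1.trans_le hx.1
    simp only [weightedTail, bigLambda]
    rw [Real.rpow_sub hx0 (1 / ν - 1) (1 / μ)]
    ring
  have h4 := integral_weightedTail_mul_powerSum hμ' h1 hb hM
  have hM' := fun x hx => norm_powerSum_div_add_le hμ' hb hM (x := x) hx
  have h5 := integral_weightedTail_mul_powerSum hν' hlam (hb.div_add hμ') hM'
  have hM'' := fun x hx => norm_powerSum_div_add_le hν' (hb.div_add hμ') hM' (x := x) hx
  -- Since n + 1/μ = (1 + μn)/μ, and likewise for ν, the two divisions produce the factor μν.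
  have hcoef : (fun n : ℕ => b n / ((n : ℂ) + (1 / μ : ℝ)) / ((n : ℂ) + (1 / ν : ℝ)))
      = fun n : ℕ => (μ * ν : ℂ) * (b n / ((1 + μ * n) * (1 + ν * n))) := by
    funext n
    have hμc : (μ : ℂ) ≠ 0 := by exact_mod_cast hμ.ne'
    have hνc : (ν : ℂ) ≠ 0 := by exact_mod_cast hν.ne'
    have e1 : (n : ℂ) + (1 / μ : ℝ) = (1 + μ * n) / μ := by
      push_cast
      field_simp
      ring
    have e2 : (n : ℂ) + (1 / ν : ℝ) = (1 + ν * n) / ν := by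
      push_cast
      field_simp
      ring
    rw [e1, e2]
    simp only [div_eq_mul_inv, mul_inv, inv_inv]
    ring
  have hK : DiscSummable fun n => b n / ((1 + μ * n) * (1 + ν * n)) := by
    have h6 := ((hb.div_add hμ').div_add hν').const_mul (μ * ν : ℂ)⁻¹
    have hμν : (μ * ν : ℂ) ≠ 0 := by exact_mod_cast (mul_pos hμ hν).ne'
    convert h6 using 2 with n
    rw [congrFun hcoef n, inv_mul_cancel_left₀ hμν]
  rw [hcoef] at h5 hM''
  simp only [powerSum_const_mul] at h5 hM''
  refine ⟨?_, ?_, ?_⟩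
  · rw [intervalIntegrable_iff_Ioo] at h2 ⊢
    exact (integrableOn_congr_fun h3 measurableSet_Ioo).1 h2
  · rw [intervalIntegrable_iff_Ioo] at hlam ⊢
    refine Integrable.mul_bdd (c := (μ * ν)⁻¹ * (M * (1 / μ)⁻¹ * (1 / ν)⁻¹)) hlam.ofReal
      ((continuousOn_powerSum_ofReal hK).aestronglyMeasurable measurableSet_Ioo) ?_
    refine (ae_restrict_mem measurableSet_Ioo).mono fun x hx => ?_
    have h7 := hM'' x hx
    rw [norm_mul, ← Complex.ofReal_mul, Complex.norm_real,
      Real.norm_of_nonneg (mul_pos hμ hν).le] at h7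
    rw [← div_eq_inv_mul, le_div_iff₀ (mul_pos hμ hν), mul_comm]
    exact h7
  · have h8 : ∫ t in (0 : ℝ)..1, ((t ^ (1 / μ - 1) * bigPi lam μ ν t : ℝ) : ℂ) *
        powerSum b (t : ℂ) = ∫ t in (0 : ℝ)..1,
          (weightedTail (1 / μ) (weightedTail (1 / ν) lam) t : ℂ) * powerSum b (t : ℂ) := by
      rw [intervalIntegral_eq_integral_Ioo, intervalIntegral_eq_integral_Ioo]
      refine setIntegral_congr_fun measurableSet_Ioo fun t ht => ?_
      simp only [h3 t ht]
    rw [h8, h4, h5, ← intervalIntegral.integral_const_mul]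
    refine intervalIntegral.integral_congr fun x _ => ?_
    ring

end Fubini

end Pascu

end

noncomputable section

namespace Pascu

open MeasureTheory Set

/-- Serves the comparisons below between series that differ only in a specially defined term of
index 0. -/
theorem powerSum_eq_sub_add {a b : ℕ → ℂ} (ha : DiscSummable a) (hb : DiscSummable b)
    (h : ∀ n, n ≠ 0 → a n = b n) {z : ℂ} (hz : ‖z‖ < 1) :
    powerSum a z = a 0 - b 0 + powerSum b z := by
  rw [powerSum_eq_zero_add ha hz, powerSum_eq_zero_add hb hz]
  simp only [h _ (Nat.succ_ne_zero _)]
  ring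

theorem powerSum_one {z : ℂ} (hz : ‖z‖ < 1) : powerSum (fun _ => 1) z = (1 - z)⁻¹ := by
  simpa [powerSum] using tsum_geometric_of_norm_lt_one hz

theorem one_sub_ne_zero {z : ℂ} (hz : ‖z‖ < 1) : 1 - z ≠ 0 := by
  intro h
  rw [← sub_eq_zero.1 h] at hz
  simp at hz

/-! ### The kernel built from h and its values on the negative radius. -/

section Kernel

/-- The Taylor coefficients of `(1 - ξ) h(z) / z + ξ h'(z)` for `h = funH ε`. -/
def pascuCoeff (ξ : ℝ) (ε : ℂ) (n : ℕ) : ℂ := (1 + ξ * n) * (1 + n * ((1 + ε) / 2))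

theorem discSummable_one_add_mul (c : ℂ) : DiscSummable fun n => 1 + n * c := by
  convert discSummable_one.add ((discSummable_one.natCast_mul).const_mul c) using 2 with n
  ring

theorem powerSum_one_add_mul (c : ℂ) {z : ℂ} (hz : ‖z‖ < 1) :
    powerSum (fun n => 1 + n * c) z = (1 - z)⁻¹ + c * (z / (1 - z) ^ 2) := by
  have h1 : powerSum (fun n => (n : ℂ)) z = z / (1 - z) ^ 2 :=
    tsum_coe_mul_geometric_of_norm_lt_one hz
  have h2 : DiscSummable fun n => (n : ℂ) := by simpa using discSummable_one.natCast_mul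
  rw [← h1, ← powerSum_one hz, ← powerSum_const_mul,
    ← powerSum_add discSummable_one (h2.const_mul c) hz]
  congr 1
  funext n
  ring

theorem discSummable_pascuCoeff (ξ : ℝ) (ε : ℂ) : DiscSummable (pascuCoeff ξ ε) := by
  have h1 := discSummable_one_add_mul ((1 + ε) / 2)
  convert h1.add (h1.natCast_mul.const_mul ξ) using 2 with n
  rw [pascuCoeff]
  ring

/-- The Taylor coefficients of `funH ε`. -/
def funHCoeff (ε : ℂ) (n : ℕ) : ℂ := if n = 0 then 0 else 1 + (n - 1) * ((1 + ε) / 2)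

theorem funHCoeff_succ (ε : ℂ) (n : ℕ) : funHCoeff ε (n + 1) = 1 + n * ((1 + ε) / 2) := by
  simp [funHCoeff]

theorem discSummable_funHCoeff (ε : ℂ) : DiscSummable (funHCoeff ε) := by
  refine DiscSummable.of_shift ?_
  simp only [funHCoeff_succ]
  exact discSummable_one_add_mul _

theorem funH_eqOn (ε : ℂ) : EqOn (funH ε) (powerSum (funHCoeff ε)) unitDisc := by
  intro z hz
  have hz' := mem_unitDisc.1 hz
  have h0 := one_sub_ne_zero hz'
  rw [powerSum_eq_zero_add (discSummable_funHCoeff ε) hz']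
  simp only [funHCoeff_succ]
  rw [powerSum_one_add_mul _ hz', funH]
  simp only [funHCoeff, if_true]
  field_simp
  ring

theorem dslope_funH_add_deriv (ξ : ℝ) (ε : ℂ) {z : ℂ} (hz : ‖z‖ < 1) :
    (1 - ξ : ℂ) * dslope (funH ε) 0 z + ξ * deriv (funH ε) z = powerSum (pascuCoeff ξ ε) z := by
  have hd := discSummable_funHCoeff ε
  rw [dslope_eqOn hd (funH_eqOn ε) (mem_unitDisc.2 hz),
    deriv_eqOn hd (funH_eqOn ε) (mem_unitDisc.2 hz), ← powerSum_const_mul, ← powerSum_const_mul,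
    ← powerSum_add (hd.shift.const_mul _) (hd.deriv.const_mul _) hz]
  congr 1
  funext n
  rw [funHCoeff_succ, pascuCoeff]
  ring

/-- For ε = 1 the function h is the Koebe function z / (1 - z)²; its values at -t account for the
terms subtracted in `funL`. -/
theorem dslope_funH_one_neg {t : ℝ} (ht : t ∈ Ioo (0 : ℝ) 1) :
    dslope (funH 1) 0 (-(t : ℂ)) = ((1 / (1 + t) ^ 2 : ℝ) : ℂ) := by
  have h0 : (-(t : ℂ)) ≠ 0 := by
    rw [neg_ne_zero]
    exact_mod_cast ht.1.ne'
  have h1 : (1 + (t : ℂ)) ≠ 0 := by exact_mod_cast (by linarith [ht.1] : (1 + t : ℝ) ≠ 0)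
  rw [dslope_of_ne _ h0, slope_def_field]
  simp only [funH]
  push_cast
  have h2 : (1 - -(t : ℂ)) ≠ 0 := by rwa [sub_neg_eq_add]
  field_simp
  ring

theorem deriv_funH_one_neg {t : ℝ} (ht : t ∈ Ioo (0 : ℝ) 1) :
    deriv (funH 1) (-(t : ℂ)) = (((1 - t) / (1 + t) ^ 3 : ℝ) : ℂ) := by
  have h1 : (1 + (t : ℂ)) ≠ 0 := by exact_mod_cast (by linarith [ht.1] : (1 + t : ℝ) ≠ 0)
  have h2 : (1 - -(t : ℂ)) ≠ 0 := by rwa [sub_neg_eq_add]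
  have h3 : funH 1 = fun z => z / (1 - z) ^ 2 := by
    funext z
    simp [funH]
  have h4 : HasDerivAt (fun z : ℂ => z / (1 - z) ^ 2) _ (-(t : ℂ)) :=
    (hasDerivAt_id' (-(t : ℂ))).fun_div (((hasDerivAt_id' (-(t : ℂ))).const_sub 1).fun_pow 2)
      (pow_ne_zero 2 h2)
  rw [h3, h4.deriv]
  push_cast
  field_simp
  ring

theorem powerSum_pascuCoeff_one_neg (ξ : ℝ) {t : ℝ} (ht : t ∈ Ioo (0 : ℝ) 1) :
    powerSum (pascuCoeff ξ 1) (-(t : ℂ))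
      = (((1 - ξ) * (1 / (1 + t) ^ 2) + ξ * ((1 - t) / (1 + t) ^ 3) : ℝ) : ℂ) := by
  rw [← dslope_funH_add_deriv ξ 1 (by rw [norm_neg]; exact ofReal_mem_unitDisc ht),
    dslope_funH_one_neg ht, deriv_funH_one_neg ht]
  push_cast
  ring

theorem norm_powerSum_pascuCoeff_one_neg_le {ξ : ℝ} (hξ0 : 0 ≤ ξ) (hξ1 : ξ ≤ 1) {t : ℝ}
    (ht : t ∈ Ioo (0 : ℝ) 1) : ‖powerSum (pascuCoeff ξ 1) (-(t : ℂ))‖ ≤ 1 := by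
  have ht0 := ht.1
  have ht1 : 0 ≤ 1 - t := by linarith [ht.2]
  have hξ' : 0 ≤ 1 - ξ := by linarith
  have h1 : 1 / (1 + t) ^ 2 ≤ 1 := by
    rw [div_le_one (by positivity)]
    nlinarith
  have h2 : (1 - t) / (1 + t) ^ 3 ≤ 1 := by
    rw [div_le_one (by positivity)]
    nlinarith [pow_pos ht0 3, pow_pos ht0 2]
  rw [powerSum_pascuCoeff_one_neg ξ ht, Complex.norm_real, Real.norm_of_nonneg (by positivity)]
  nlinarith

theorem funL_eq (ξ : ℝ) (ε : ℂ) {z : ℂ} (hz : ‖z‖ < 1) {t : ℝ} (ht : t ∈ Ioo (0 : ℝ) 1) :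
    funL ξ ε z t = (powerSum (pascuCoeff ξ ε) (z * t)).re
      - (powerSum (pascuCoeff ξ 1) (-(t : ℂ))).re := by
  have htz : ‖(t : ℂ) * z‖ < 1 := by
    rw [norm_mul]
    exact mul_lt_one_of_nonneg_of_lt_one_left (norm_nonneg _) (ofReal_mem_unitDisc ht) hz.le
  rw [powerSum_pascuCoeff_one_neg ξ ht, Complex.ofReal_re, mul_comm z,
    ← dslope_funH_add_deriv ξ ε htz, funL,
    show (1 - ξ : ℂ) = ((1 - ξ : ℝ) : ℂ) by push_cast; ring, Complex.add_re,
    Complex.re_ofReal_mul, Complex.re_ofReal_mul]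
  ring

end Kernel

/-! ### The functional N in terms of the convolution coefficients. -/

section Criterion

/-- The coefficients `(1 - ρ) τₙ (1 + ξ n) (1 + n (1 + ε) / 2) / ((1 + μ n) (1 + ν n))`, `n ≥ 1`,
where `τₙ` are the moments of `lam`. -/
def criterionCoeff (lam : ℝ → ℝ) (ρ μ ν ξ : ℝ) (ε : ℂ) (n : ℕ) : ℂ :=
  if n = 0 then 0 else (1 - ρ) * moment lam n * (pascuCoeff ξ ε n / ((1 + μ * n) * (1 + ν * n)))

variable {lam : ℝ → ℝ} {ρ μ ν ξ : ℝ}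

theorem norm_moment_le (hlam : IntervalIntegrable lam volume 0 1) (n : ℕ) :
    ‖(moment lam n : ℂ)‖ ≤ ∫ t in (0 : ℝ)..1, |lam t| := by
  rw [Complex.norm_real, moment]
  refine intervalIntegral.norm_integral_le_of_norm_le zero_le_one (ae_of_all _ fun t ht => ?_)
    hlam.abs
  rw [norm_mul, norm_pow, Real.norm_eq_abs, Real.norm_of_nonneg ht.1.le]
  exact mul_le_of_le_one_right (abs_nonneg _) (pow_le_one₀ ht.1.le ht.2)

theorem DiscSummable.moment_mul (hlam : IntervalIntegrable lam volume 0 1) {a : ℕ → ℂ}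
    (ha : DiscSummable a) : DiscSummable fun n => moment lam n * a n :=
  ha.of_le_const _ fun n => by
    rw [norm_mul]
    gcongr
    exact norm_moment_le hlam n

theorem one_add_mul_ne_zero (hμ : 0 < μ) (n : ℕ) : (1 + μ * n : ℂ) ≠ 0 := by
  have h : (1 + μ * n : ℝ) ≠ 0 := by positivity
  exact_mod_cast h

theorem DiscSummable.div_one_add_mul (hμ : 0 < μ) {a : ℕ → ℂ} (ha : DiscSummable a) :
    DiscSummable fun n => a n / (1 + μ * n) :=
  ha.of_le_const 1 fun n => by
    have h1 : ‖(1 + μ * n : ℂ)‖ = 1 + μ * n := by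
      rw [show (1 + μ * n : ℂ) = ((1 + μ * n : ℝ) : ℂ) by push_cast; ring, Complex.norm_real,
        Real.norm_of_nonneg (by positivity)]
    rw [norm_div, h1, one_mul]
    refine div_le_self (norm_nonneg _) ?_
    have : 0 ≤ μ * n := by positivity
    linarith

theorem DiscSummable.div_one_add_mul_mul (hμ : 0 < μ) (hν : 0 < ν) {a : ℕ → ℂ}
    (ha : DiscSummable a) : DiscSummable fun n => a n / ((1 + μ * n) * (1 + ν * n)) := by
  simpa only [div_div] using (ha.div_one_add_mul hμ).div_one_add_mul hν

theorem discSummable_criterionCoeff (hlam : IntervalIntegrable lam volume 0 1) (hμ : 0 < μ)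
    (hν : 0 < ν) (ε : ℂ) : DiscSummable (criterionCoeff lam ρ μ ν ξ ε) := by
  have h1 := ((((discSummable_pascuCoeff ξ ε).div_one_add_mul_mul hμ hν).moment_mul
    hlam).const_mul (1 - ρ))
  refine h1.of_le_const 1 fun n => ?_
  rw [criterionCoeff]
  split_ifs
  · rw [norm_zero]
    positivity
  · rw [one_mul, mul_assoc]

theorem integral_mul_powerSum_pascuCoeff (hμ : 0 < μ) (hν : 0 < ν)
    (hlam : IntervalIntegrable lam volume 0 1) (hlam_one : ∫ t in (0 : ℝ)..1, lam t = 1)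
    (hρ : ρ < 1) (ε : ℂ) {z : ℂ} (hz : ‖z‖ < 1) :
    ∫ x in (0 : ℝ)..1, (lam x : ℂ) *
      powerSum (fun n => pascuCoeff ξ ε n * z ^ n / ((1 + μ * n) * (1 + ν * n))) (x : ℂ)
      = 1 + powerSum (criterionCoeff lam ρ μ ν ξ ε) z / (1 - ρ) := by
  have hρ' : (1 - ρ : ℂ) ≠ 0 := by exact_mod_cast (sub_pos.2 hρ).ne'
  have hK := (discSummable_pascuCoeff ξ ε).div_one_add_mul_mul hμ hν
  have h1 : Summable fun n => ‖pascuCoeff ξ ε n * z ^ n / ((1 + μ * n) * (1 + ν * n))‖ := by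
    simpa only [div_mul_eq_mul_div] using hK.summable_norm hz
  rw [← (hasSum_mul_moment hlam h1).tsum_eq]
  have h2 : ∑' n : ℕ, pascuCoeff ξ ε n * z ^ n / ((1 + μ * n) * (1 + ν * n)) * (moment lam n : ℂ)
      = powerSum (fun n => moment lam n * (pascuCoeff ξ ε n / ((1 + μ * n) * (1 + ν * n)))) z := by
    refine tsum_congr fun n => ?_
    ring
  have hc := (discSummable_criterionCoeff (ρ := ρ) (ξ := ξ) hlam hμ hν ε).const_mul (1 - ρ)⁻¹
  rw [h2, powerSum_eq_sub_add (hK.moment_mul hlam) hc ?_ hz, powerSum_const_mul]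
  · have h3 : moment lam 0 = 1 := by simpa [moment] using hlam_one
    simp only [h3, criterionCoeff, pascuCoeff, if_true]
    simp
    ring
  · intro n hn
    rw [criterionCoeff, if_neg hn]
    field_simp

/-- For ε = 1 the kernel coefficient splits as (1 + ξn)(1 + n) = (1 - ξ)(n + 1) + ξ(n + 1)²,
matching the series in g and q. -/
theorem auxG_auxQ_eq (hμ : 0 < μ) (hν : 0 < ν) (ξ : ℝ) {t : ℝ} (ht : t ∈ Ioo (0 : ℝ) 1) :
    (1 - ξ) * ((1 - auxG μ ν t) / 2) + ξ * (1 - auxQ μ ν t)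
      = 1 - (powerSum (fun n => pascuCoeff ξ 1 n * (-1) ^ n / ((1 + μ * n) * (1 + ν * n)))
          (t : ℂ)).re := by
  have hone : DiscSummable fun n => ((n : ℂ) + 1) * 1 := discSummable_one.deriv
  have hn1 : DiscSummable fun n => ((n : ℂ) + 1) := by simpa using hone
  have hn2 : DiscSummable fun n => ((n : ℂ) + 1) ^ 2 := by
    convert hn1.add hn1.natCast_mul using 2 with n
    ring
  have hneg : ‖(-1 : ℂ)‖ ≤ 1 := by simp
  have hd1 := (hn1.mul_geom hneg).div_one_add_mul_mul hμ hν
  have hd2 := (hn2.mul_geom hneg).div_one_add_mul_mul hμ hν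
  have ht' := ofReal_mem_unitDisc ht
  have h1 : ((∑' n : ℕ, ((n : ℝ) + 1) * (-1) ^ n * t ^ n / ((1 + μ * n) * (1 + ν * n)) : ℝ) : ℂ)
      = powerSum (fun n => ((n : ℂ) + 1) * (-1) ^ n / ((1 + μ * n) * (1 + ν * n))) (t : ℂ) := by
    rw [Complex.ofReal_tsum, powerSum]
    refine tsum_congr fun n => ?_
    push_cast
    ring
  have h2 : ((auxQ μ ν t : ℝ) : ℂ)
      = powerSum (fun n => ((n : ℂ) + 1) ^ 2 * (-1) ^ n / ((1 + μ * n) * (1 + ν * n)))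
          (t : ℂ) := by
    rw [auxQ, Complex.ofReal_tsum, powerSum]
    refine tsum_congr fun n => ?_
    push_cast
    ring
  have h3 : powerSum (fun n => pascuCoeff ξ 1 n * (-1) ^ n / ((1 + μ * n) * (1 + ν * n))) (t : ℂ)
      = (1 - ξ : ℂ) *
          powerSum (fun n => ((n : ℂ) + 1) * (-1) ^ n / ((1 + μ * n) * (1 + ν * n))) (t : ℂ)
        + ξ * powerSum (fun n => ((n : ℂ) + 1) ^ 2 * (-1) ^ n / ((1 + μ * n) * (1 + ν * n)))
          (t : ℂ) := by
    rw [← powerSum_const_mul, ← powerSum_const_mul,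
      ← powerSum_add (hd1.const_mul _) (hd2.const_mul _) ht']
    congr 1
    funext n
    rw [pascuCoeff]
    ring
  rw [h3, ← h1, ← h2, show (1 - ξ : ℂ) = ((1 - ξ : ℝ) : ℂ) by push_cast; ring, Complex.add_re,
    Complex.re_ofReal_mul, Complex.re_ofReal_mul, Complex.ofReal_re, Complex.ofReal_re, auxG]
  ring

theorem re_intervalIntegral {f : ℝ → ℂ} (hf : IntervalIntegrable f volume 0 1) :
    (∫ t in (0 : ℝ)..1, f t).re = ∫ t in (0 : ℝ)..1, (f t).re := by
  exact (Complex.reCLM.intervalIntegral_comp_comm hf).symm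

theorem exists_bound_powerSum_mul {b : ℕ → ℂ} (hb : DiscSummable b) {z : ℂ} (hz : ‖z‖ < 1) :
    ∃ M : ℝ, ∀ t ∈ Ioo (0 : ℝ) 1, ‖powerSum b (z * t)‖ ≤ M := by
  have h1 : ContinuousOn (fun t : ℝ => powerSum b (z * t)) (Icc 0 1) := by
    refine hb.differentiableOn.continuousOn.comp (by fun_prop) fun t ht => ?_
    rw [mem_unitDisc, norm_mul, Complex.norm_real, Real.norm_of_nonneg ht.1]
    exact (mul_le_of_le_one_right (norm_nonneg _) ht.2).trans_lt hz
  obtain ⟨M, hM⟩ := isCompact_Icc.exists_bound_of_continuousOn h1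
  exact ⟨M, fun t ht => hM t (Ioo_subset_Icc_self ht)⟩

theorem intervalIntegrable_ofReal_mul_powerSum {w : ℝ → ℝ} (hw : IntervalIntegrable w volume 0 1)
    {b : ℕ → ℂ} (hb : DiscSummable b) {M : ℝ}
    (hM : ∀ t ∈ Ioo (0 : ℝ) 1, ‖powerSum b (t : ℂ)‖ ≤ M) :
    IntervalIntegrable (fun t => (w t : ℂ) * powerSum b (t : ℂ)) volume 0 1 := by
  rw [intervalIntegrable_iff_Ioo] at hw ⊢
  exact Integrable.mul_bdd (c := M) hw.ofReal
    ((continuousOn_powerSum_ofReal hb).aestronglyMeasurable measurableSet_Ioo)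
    ((ae_restrict_mem measurableSet_Ioo).mono hM)

/-- The integrals defining `funN` in terms of the coefficients of the convolution criterion. -/
theorem integral_bigPi_mul_funL {β : ℝ} (hμ : 0 < μ) (hν : 0 < ν) (hξ0 : 0 ≤ ξ) (hξ1 : ξ ≤ 1)
    (hβ : β < 1) (hρ : ρ < 1)
    (hlam : IntervalIntegrable lam volume 0 1) (hlam_one : ∫ t in (0 : ℝ)..1, lam t = 1)
    (hβρ : 1 / (2 * (1 - β) * (1 - ρ)) =
      ∫ t in (0 : ℝ)..1, lam t *
        ((1 - ξ) * ((1 - auxG μ ν t) / 2) + ξ * (1 - auxQ μ ν t)))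
    (ε : ℂ) {z : ℂ} (hz : ‖z‖ < 1) :
    ∫ t in (0 : ℝ)..1, t ^ (1 / μ - 1) * bigPi lam μ ν t * funL ξ ε z t
      = μ * ν / (1 - ρ) *
        ((powerSum (criterionCoeff lam ρ μ ν ξ ε) z).re + 1 / (2 * (1 - β))) := by
  have hρ' : 1 - ρ ≠ 0 := (sub_pos.2 hρ).ne'
  have hβ' : 1 - β ≠ 0 := (sub_pos.2 hβ).ne'
  set w : ℝ → ℝ := fun t => t ^ (1 / μ - 1) * bigPi lam μ ν t with hw_def
  have hb1 := (discSummable_pascuCoeff ξ ε).mul_geom hz.le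
  have hb2 := (discSummable_pascuCoeff ξ 1).mul_geom (w := -1) (by simp)
  obtain ⟨M, hM⟩ := exists_bound_powerSum_mul (discSummable_pascuCoeff ξ ε) hz
  have hM1 : ∀ t ∈ Ioo (0 : ℝ) 1,
      ‖powerSum (fun n => pascuCoeff ξ ε n * z ^ n) (t : ℂ)‖ ≤ M := by
    intro t ht
    rw [powerSum_mul_pow]
    exact hM t ht
  have hM2 : ∀ t ∈ Ioo (0 : ℝ) 1,
      ‖powerSum (fun n => pascuCoeff ξ 1 n * (-1) ^ n) (t : ℂ)‖ ≤ 1 := by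
    intro t ht
    rw [powerSum_mul_pow, neg_one_mul]
    exact norm_powerSum_pascuCoeff_one_neg_le hξ0 hξ1 ht
  obtain ⟨hw, -, e1⟩ := integral_bigPi_mul_powerSum hμ hν hlam hb1 hM1
  obtain ⟨-, hi2, e2⟩ := integral_bigPi_mul_powerSum hμ hν hlam hb2 hM2
  have hi1 := intervalIntegrable_ofReal_mul_powerSum hw hb1 hM1
  have hi3 := intervalIntegrable_ofReal_mul_powerSum hw hb2 hM2
  have h1 : ∫ t in (0 : ℝ)..1, w t * funL ξ ε z t
      = (∫ t in (0 : ℝ)..1, (w t : ℂ) * powerSum (fun n => pascuCoeff ξ ε n * z ^ n) (t : ℂ)).re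
        - (∫ t in (0 : ℝ)..1,
            (w t : ℂ) * powerSum (fun n => pascuCoeff ξ 1 n * (-1) ^ n) (t : ℂ)).re := by
    rw [← Complex.sub_re, ← intervalIntegral.integral_sub hi1 hi3,
      re_intervalIntegral (hi1.sub hi3), intervalIntegral_eq_integral_Ioo,
      intervalIntegral_eq_integral_Ioo]
    refine setIntegral_congr_fun measurableSet_Ioo fun t ht => ?_
    simp only [powerSum_mul_pow, neg_one_mul, Complex.sub_re, Complex.re_ofReal_mul]
    rw [funL_eq ξ ε hz ht]
    ring
  -- Here the relation between β and ρ enters; it replaces the contribution of the negative radius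
  -- by an explicit constant.
  have h2 : (∫ x in (0 : ℝ)..1, (lam x : ℂ) *
      powerSum (fun n => pascuCoeff ξ 1 n * (-1) ^ n / ((1 + μ * n) * (1 + ν * n))) (x : ℂ)).re
      = 1 - 1 / (2 * (1 - β) * (1 - ρ)) := by
    have hi2' : IntervalIntegrable _ volume 0 1 := ⟨hi2.1.re, hi2.2.re⟩
    rw [re_intervalIntegral hi2, hβρ]
    refine Eq.trans ?_ (congrArg (· - _) hlam_one)
    rw [← intervalIntegral.integral_sub hlam]
    · rw [intervalIntegral_eq_integral_Ioo, intervalIntegral_eq_integral_Ioo]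
      refine setIntegral_congr_fun measurableSet_Ioo fun t ht => ?_
      simp only [auxG_auxQ_eq hμ hν ξ ht, Complex.re_ofReal_mul]
      ring
    -- The integrand with g and q is integrable because it agrees on (0, 1) with a difference of two
    -- integrable functions.
    · have h3 := hlam.sub hi2'
      rw [intervalIntegrable_iff_Ioo] at h3 ⊢
      refine (integrableOn_congr_fun (fun t ht => ?_) measurableSet_Ioo).1 h3
      simp only [auxG_auxQ_eq hμ hν ξ ht, RCLike.re_to_complex, Complex.re_ofReal_mul]
      ring
  have h4 := integral_mul_powerSum_pascuCoeff (ξ := ξ) hμ hν hlam hlam_one hρ ε hz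
  have hw' : ∀ t : ℝ, t ^ (1 / μ - 1) * bigPi lam μ ν t = w t := fun _ => rfl
  simp only [hw'] at e1 e2 ⊢
  rw [h1, e1, e2, h4, ← Complex.ofReal_mul, Complex.re_ofReal_mul, Complex.re_ofReal_mul, h2,
    show (1 - ρ : ℂ) = ((1 - ρ : ℝ) : ℂ) by push_cast; ring, Complex.add_re, Complex.one_re,
    Complex.div_ofReal_re]
  field_simp
  ring

theorem funN_nonneg_iff {β : ℝ} (hμ : 0 < μ) (hν : 0 < ν) (hξ0 : 0 ≤ ξ) (hξ1 : ξ ≤ 1)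
    (hβ : β < 1) (hρ : ρ < 1)
    (hlam : IntervalIntegrable lam volume 0 1) (hlam_one : ∫ t in (0 : ℝ)..1, lam t = 1)
    (hβρ : 1 / (2 * (1 - β) * (1 - ρ)) =
      ∫ t in (0 : ℝ)..1, lam t *
        ((1 - ξ) * ((1 - auxG μ ν t) / 2) + ξ * (1 - auxQ μ ν t)))
    (ε : ℂ) :
    0 ≤ funN lam μ ν ξ ε ↔ ∀ z : ℂ, ‖z‖ < 1 →
      -(1 / (2 * (1 - β))) ≤ (powerSum (criterionCoeff lam ρ μ ν ξ ε) z).re := by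
  have hpos : 0 < μ * ν / (1 - ρ) := div_pos (mul_pos hμ hν) (sub_pos.2 hρ)
  rw [funN, le_iInf₂_iff]
  refine forall_congr' fun z => ?_
  rw [mem_unitDisc]
  refine forall_congr' fun hz => ?_
  rw [integral_bigPi_mul_funL hμ hν hξ0 hξ1 hβ hρ hlam hlam_one hβρ ε hz, EReal.coe_nonneg,
    mul_nonneg_iff_of_pos_left hpos, neg_le_iff_add_nonneg]

end Criterion

/-! ### Both integral operators as coefficient multipliers. -/

section Operators

variable {lam : ℝ → ℝ} {ρ : ℝ}

/-- The Taylor coefficients of `(1 - ρ z) / (1 - z)`. -/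
def kernelCoeff (ρ : ℝ) (n : ℕ) : ℂ := if n = 0 then 1 else 1 - ρ

/-- The multiplier sequence of `opGenV`. -/
def opGenVCoeff (lam : ℝ → ℝ) (ρ : ℝ) (n : ℕ) : ℂ :=
  if n = 0 then 0 else moment lam (n - 1) * kernelCoeff ρ (n - 1)

theorem opGenVCoeff_succ (lam : ℝ → ℝ) (ρ : ℝ) (n : ℕ) :
    opGenVCoeff lam ρ (n + 1) = moment lam n * kernelCoeff ρ n := by
  simp [opGenVCoeff]

theorem discSummable_kernelCoeff (ρ : ℝ) : DiscSummable (kernelCoeff ρ) :=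
  discSummable_one.of_le_const (max 1 ‖(1 - ρ : ℂ)‖) fun n => by
    rw [kernelCoeff]
    split_ifs <;> simp

theorem powerSum_kernelCoeff (ρ : ℝ) {z : ℂ} (hz : ‖z‖ < 1) :
    powerSum (kernelCoeff ρ) z = (1 - ρ * z) / (1 - z) := by
  have h0 := one_sub_ne_zero hz
  rw [powerSum_eq_sub_add (discSummable_kernelCoeff ρ) (discSummable_one.const_mul (1 - ρ)) ?_ hz,
    powerSum_const_mul, powerSum_one hz]
  · simp only [kernelCoeff, if_true]
    field_simp
    ring
  · intro n hn
    simp [kernelCoeff, hn]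

theorem discSummable_opGenVCoeff (hlam : IntervalIntegrable lam volume 0 1) (ρ : ℝ) :
    DiscSummable (opGenVCoeff lam ρ) := by
  refine DiscSummable.of_shift ?_
  simp only [opGenVCoeff_succ]
  exact (discSummable_kernelCoeff ρ).moment_mul hlam

theorem opGenV_kernel_eqOn (hlam : IntervalIntegrable lam volume 0 1) (ρ : ℝ) :
    EqOn (fun z : ℂ => z * ∫ t in (0 : ℝ)..1,
      (lam t : ℂ) * ((1 - (ρ : ℂ) * (t : ℂ) * z) / (1 - (t : ℂ) * z)))
      (powerSum (opGenVCoeff lam ρ)) unitDisc := by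
  intro z hz
  have hz' := mem_unitDisc.1 hz
  rw [powerSum_eq_zero_add (discSummable_opGenVCoeff hlam ρ) hz']
  simp only [opGenVCoeff_succ]
  have h1 := hasSum_mul_moment hlam ((discSummable_kernelCoeff ρ).summable_norm hz')
  have h2 : ∫ t in (0 : ℝ)..1, (lam t : ℂ) *
        powerSum (fun n => kernelCoeff ρ n * z ^ n) (t : ℂ)
      = ∫ t in (0 : ℝ)..1,
        (lam t : ℂ) * ((1 - (ρ : ℂ) * (t : ℂ) * z) / (1 - (t : ℂ) * z)) := by
    rw [intervalIntegral_eq_integral_Ioo, intervalIntegral_eq_integral_Ioo]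
    refine setIntegral_congr_fun measurableSet_Ioo fun t ht => ?_
    have htz : ‖z * (t : ℂ)‖ < 1 := by
      rw [norm_mul]
      exact mul_lt_one_of_nonneg_of_lt_one_left (norm_nonneg _) hz' (ofReal_mem_unitDisc ht).le
    simp only [powerSum_mul_pow]
    rw [powerSum_kernelCoeff ρ htz, mul_comm z (t : ℂ), mul_assoc]
  rw [← h2, ← h1.tsum_eq, powerSum]
  simp only [opGenVCoeff, if_true, zero_add]
  congr 1
  refine tsum_congr fun n => ?_
  ring

theorem opGenV_eq_powerSum (hlam : IntervalIntegrable lam volume 0 1) (ρ : ℝ) (f : ℂ → ℂ) :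
    opGenV lam ρ f = powerSum fun n => opGenVCoeff lam ρ n * taylorCoeff f n := by
  funext z
  rw [opGenV, hadamard,
    taylorCoeff_eq_of_eqOn (discSummable_opGenVCoeff hlam ρ) (opGenV_kernel_eqOn hlam ρ), powerSum]

theorem opV_eq_mul_powerSum (hlam : IntervalIntegrable lam volume 0 1) {f : ℂ → ℂ} {a : ℕ → ℂ}
    (ha : DiscSummable a) (hf : EqOn f (powerSum a) unitDisc) (ha0 : a 0 = 0) {z : ℂ}
    (hz : ‖z‖ < 1) :
    opV lam f z = z * powerSum (fun n => moment lam n * a (n + 1)) z := by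
  have h1 := hasSum_mul_moment hlam (ha.shift.summable_norm hz)
  have h2 : opV lam f z = z * ∫ t in (0 : ℝ)..1, (lam t : ℂ) *
      powerSum (fun n => a (n + 1) * z ^ n) (t : ℂ) := by
    rw [opV, ← intervalIntegral.integral_const_mul, intervalIntegral_eq_integral_Ioo,
      intervalIntegral_eq_integral_Ioo]
    refine setIntegral_congr_fun measurableSet_Ioo fun t ht => ?_
    have htz : ‖(t : ℂ) * z‖ < 1 := by
      rw [norm_mul]
      exact mul_lt_one_of_nonneg_of_lt_one_left (norm_nonneg _) (ofReal_mem_unitDisc ht) hz.le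
    have ht0 : (t : ℂ) ≠ 0 := by exact_mod_cast ht.1.ne'
    simp only [powerSum_mul_pow]
    rw [hf (mem_unitDisc.2 htz), powerSum_eq_zero_add ha htz, ha0, mul_comm z (t : ℂ)]
    field_simp
    ring
  rw [h2, ← h1.tsum_eq, powerSum]
  congr 1
  refine tsum_congr fun n => ?_
  ring

/-- After division by z, the multipliers are (1 - ρ) τₙ for n ≥ 1, and at n = 0 the value 1 = ρ + (1
- ρ) τ₀; the surplus ρ is the term ρz. -/
theorem opGenV_eq (hlam : IntervalIntegrable lam volume 0 1)
    (hlam_one : ∫ t in (0 : ℝ)..1, lam t = 1) {f : ℂ → ℂ} (hf : f ∈ classA) {z : ℂ}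
    (hz : z ∈ unitDisc) :
    opGenV lam ρ f z = (ρ : ℂ) * z + (1 - ρ : ℂ) * opV lam f z := by
  obtain ⟨hd, h0, h1⟩ := hf
  have hz' := mem_unitDisc.1 hz
  have ha := discSummable_taylorCoeff hd
  have ha0 : taylorCoeff f 0 = 0 := by rw [taylorCoeff_zero, h0]
  have ha1 : taylorCoeff f 1 = 1 := by rw [taylorCoeff_one, h1]
  have hτ : moment lam 0 = 1 := by simpa [moment] using hlam_one
  have hs := ha.shift.moment_mul hlam
  have hk := (discSummable_opGenVCoeff hlam ρ).mul ha
  rw [opGenV_eq_powerSum hlam, opV_eq_mul_powerSum hlam ha (eqOn_powerSum_taylorCoeff hd) ha0 hz',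
    powerSum_eq_zero_add hk hz',
    powerSum_eq_sub_add (b := fun n => (1 - ρ) * (moment lam n * taylorCoeff f (n + 1)))
      hk.shift (hs.const_mul (1 - ρ)) ?_ hz', powerSum_const_mul]
  · simp only [opGenVCoeff_succ, ha0, hτ, zero_add, ha1, kernelCoeff, if_true]
    push_cast
    ring
  · intro n hn
    rw [opGenVCoeff_succ, kernelCoeff, if_neg hn]
    ring

end Operators

/-! ### Coefficients for W and the zero-free criterion for transforms. -/

section Main

variable {α γ μ ν ξ ρ : ℝ} {lam : ℝ → ℝ}

/-- The factor of aₙ₊₁ is (1 - α + 2γ) + (α - 2γ)(n + 1) + γ n(n + 1) = 1 + (α - γ) n + γ n², whose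
factorization is the purpose of μ and ν. -/
theorem classW_expr_eqOn (hsum : μ + ν = α - γ) (hprod : μ * ν = γ) {f : ℂ → ℂ} {a : ℕ → ℂ}
    (ha : DiscSummable a) (hf : EqOn f (powerSum a) unitDisc) :
    EqOn (fun z => (1 - α + 2 * γ : ℂ) * dslope f 0 z + (α - 2 * γ : ℂ) * deriv f z
        + (γ : ℂ) * z * deriv (deriv f) z)
      (powerSum fun n => (1 + μ * n) * (1 + ν * n) * a (n + 1)) unitDisc := by
  intro z hz
  have hz' := mem_unitDisc.1 hz
  have h1 := deriv_eqOn ha hf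
  have h2 : z * deriv (deriv f) z = _ := mul_deriv_eqOn ha.deriv h1 hz
  simp only [mul_assoc (γ : ℂ)]
  rw [h2, dslope_eqOn ha hf hz, h1 hz, ← powerSum_const_mul, ← powerSum_const_mul,
    ← powerSum_const_mul, ← powerSum_add (ha.shift.const_mul _) (ha.deriv.const_mul _) hz',
    ← powerSum_add ((ha.shift.const_mul _).add (ha.deriv.const_mul _))
      (ha.deriv.natCast_mul.const_mul _) hz']
  congr 1
  funext n
  have e1 : (μ + ν : ℂ) = α - γ := by exact_mod_cast hsum
  have e2 : (μ * ν : ℂ) = γ := by exact_mod_cast hprod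
  linear_combination (-(n : ℂ) * a (n + 1)) * e1 - (n : ℂ) ^ 2 * a (n + 1) * e2

theorem discSummable_one_add_mul_mul {a : ℕ → ℂ} (ha : DiscSummable a) (μ ν : ℝ) :
    DiscSummable fun n => (1 + μ * n) * (1 + ν * n) * a n := by
  have h1 := ha.add (ha.natCast_mul.const_mul μ)
  convert h1.add (h1.natCast_mul.const_mul ν) using 2 with n
  ring

/-- The convolution with `funH ε` of the image of `f` under `opGenV`. -/
theorem powerSum_pascuCoeff_mul_opGenVCoeff (hμ : 0 < μ) (hν : 0 < ν)
    (hlam : IntervalIntegrable lam volume 0 1) (hlam_one : ∫ t in (0 : ℝ)..1, lam t = 1)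
    {a : ℕ → ℂ} (ha : DiscSummable a) (ha1 : a 1 = 1) (ε : ℂ) {z : ℂ} (hz : ‖z‖ < 1) :
    powerSum (fun n => (1 + ξ * n) * (1 + n * ((1 + ε) / 2))
        * (opGenVCoeff lam ρ (n + 1) * a (n + 1))) z
      = 1 + powerSum (fun n => criterionCoeff lam ρ μ ν ξ ε n
          * ((1 + μ * n) * (1 + ν * n) * a (n + 1))) z := by
  have hτ : moment lam 0 = 1 := by simpa [moment] using hlam_one
  have hl : DiscSummable fun n => pascuCoeff ξ ε n * (opGenVCoeff lam ρ (n + 1) * a (n + 1)) :=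
    (discSummable_pascuCoeff ξ ε).mul ((discSummable_opGenVCoeff hlam ρ).mul ha).shift
  have hr := (discSummable_criterionCoeff (ρ := ρ) (ξ := ξ) hlam hμ hν ε).mul
    (discSummable_one_add_mul_mul ha.shift μ ν)
  have h1 := powerSum_eq_sub_add hl hr ?_ hz
  · simp only [pascuCoeff] at h1
    rw [h1]
    simp [criterionCoeff, opGenVCoeff, kernelCoeff, hτ, ha1]
  · intro n hn
    have e := mul_ne_zero (one_add_mul_ne_zero hμ n) (one_add_mul_ne_zero hν n)
    rw [opGenVCoeff_succ, kernelCoeff, if_neg hn, criterionCoeff, if_neg hn,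
      ← mul_assoc _ ((1 + μ * n : ℂ) * (1 + ν * n)), mul_assoc _ (_ / _), div_mul_cancel₀ _ e]
    ring

theorem opGenV_mem_classM_iff (hμ : 0 < μ) (hν : 0 < ν)
    (hlam : IntervalIntegrable lam volume 0 1) (hlam_one : ∫ t in (0 : ℝ)..1, lam t = 1)
    {f : ℂ → ℂ} (hf : f ∈ classA) :
    opGenV lam ρ f ∈ classM ξ ↔ ∀ ε : ℂ, ‖ε‖ = 1 → ∀ z : ℂ, ‖z‖ < 1 →
      1 + powerSum (fun n => criterionCoeff lam ρ μ ν ξ ε n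
          * ((1 + μ * n) * (1 + ν * n) * taylorCoeff f (n + 1))) z ≠ 0 := by
  obtain ⟨hd, h0, h1⟩ := hf
  have ha := discSummable_taylorCoeff hd
  have ha1 : taylorCoeff f 1 = 1 := by rw [taylorCoeff_one, h1]
  have hτ : moment lam 0 = 1 := by simpa [moment] using hlam_one
  rw [opGenV_eq_powerSum hlam,
    mem_classM_iff ((discSummable_opGenVCoeff hlam ρ).mul ha) (fun _ _ => rfl)
      (by simp [opGenVCoeff]) (by simp [opGenVCoeff, kernelCoeff, hτ, ha1])]
  refine forall_congr' fun ε => forall_congr' fun _ => forall_congr' fun z =>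
    forall_congr' fun hz => ?_
  rw [powerSum_pascuCoeff_mul_opGenVCoeff hμ hν hlam hlam_one ha ha1 ε hz]

end Main

end Pascu

end

theorem mainTheorem9 (α γ μ ν ξ β ρ : ℝ) (lam : ℝ → ℝ)
    (hμ : 0 < μ) (hν : 0 < ν) (hsum : μ + ν = α - γ) (hprod : μ * ν = γ)
    (hξ0 : 0 ≤ ξ) (hξ1 : ξ ≤ 1) (hβ : β < 1) (hρ : ρ < 1)
    (hlam_nonneg : ∀ t ∈ Set.Ioo (0 : ℝ) 1, 0 ≤ lam t)
    (hlam_int : IntervalIntegrable lam MeasureTheory.volume 0 1)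
    (hlam_one : ∫ t in (0 : ℝ)..1, lam t = 1)
    (hβρ : 1 / (2 * (1 - β) * (1 - ρ)) =
      ∫ t in (0 : ℝ)..1, lam t *
        ((1 - ξ) * ((1 - Pascu.auxG μ ν t) / 2) + ξ * (1 - Pascu.auxQ μ ν t))) :
    (∀ f ∈ Pascu.classA, ∀ z ∈ Pascu.unitDisc,
      Pascu.opGenV lam ρ f z = (ρ : ℂ) * z + (1 - ρ : ℂ) * Pascu.opV lam f z) ∧
    (Pascu.opGenV lam ρ '' Pascu.classW β α γ ⊆ Pascu.classM ξ ↔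
      ∀ ε : ℂ, ‖ε‖ = 1 → 0 ≤ Pascu.funN lam μ ν ξ ε) := by
  refine ⟨fun f hf z hz => Pascu.opGenV_eq hlam_int hlam_one hf hz, ?_, ?_⟩
  · intro h ε hε
    rw [Pascu.funN_nonneg_iff hμ hν hξ0 hξ1 hβ hρ hlam_int hlam_one hβρ]
    intro z₀ hz₀
    by_contra hneg
    have hc := Pascu.discSummable_criterionCoeff (ρ := ρ) (ξ := ξ) hlam_int hμ hν ε
    obtain ⟨η, φ, z, hz, hzero, hφ⟩ := Pascu.exists_one_add_mul_powerSum_eq_zero hc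
      (by simp [Pascu.criterionCoeff]) hβ hz₀ (not_le.1 hneg)
    -- Coefficients of the extremal 1 + (1 - β)(1 + η) z / (1 - z).
    set p : ℕ → ℂ := fun n => if n = 0 then 1 else (1 - β) * (1 + η) with hp_def
    have hp : Pascu.DiscSummable p :=
      Pascu.discSummable_one.of_le_const (max 1 ‖(1 - β : ℂ) * (1 + η)‖) fun n => by
        rw [hp_def]
        by_cases hn : n = 0 <;> simp [hn]
    -- Coefficients of the f whose W-expression is this p, obtained by dividing out (1 + μn)(1 +
    -- νn). The truncated n - 1 is harmless, as n = 0 is treated apart.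
    set a : ℕ → ℂ := fun n =>
      if n = 0 then 0 else p (n - 1) / ((1 + μ * (n - 1 : ℕ)) * (1 + ν * (n - 1 : ℕ))) with ha_def
    have ha_succ : ∀ n, a (n + 1) = p n / ((1 + μ * n) * (1 + ν * n)) := by
      intro n
      simp [ha_def]
    have ha : Pascu.DiscSummable a := by
      refine Pascu.DiscSummable.of_shift ?_
      simp only [ha_succ]
      exact hp.div_one_add_mul_mul hμ hν
    have ha0 : a 0 = 0 := by simp [ha_def]
    have ha1 : a 1 = 1 := by simp [ha_def, hp_def]
    have hpa : ∀ n : ℕ, (1 + μ * n) * (1 + ν * n) * a (n + 1) = p n := by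
      intro n
      rw [ha_succ, mul_div_cancel₀]
      exact mul_ne_zero (Pascu.one_add_mul_ne_zero hμ n) (Pascu.one_add_mul_ne_zero hν n)
    have hta := ha.taylorCoeff_powerSum
    have hfA : Pascu.powerSum a ∈ Pascu.classA := by
      refine ⟨ha.differentiableOn, ?_, ?_⟩
      · rw [Pascu.powerSum_zero, ha0]
      · rw [← Pascu.taylorCoeff_one, hta, ha1]
    have hfW : Pascu.powerSum a ∈ Pascu.classW β α γ := by
      refine ⟨hfA, φ, fun w hw => ?_⟩
      have h1 := Pascu.classW_expr_eqOn hsum hprod ha (fun _ _ => rfl) hw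
      simp only [hpa] at h1
      have hw' := Pascu.mem_unitDisc.1 hw
      have h0 := Pascu.one_sub_ne_zero hw'
      rw [Pascu.powerSum_eq_sub_add hp
        (Pascu.discSummable_one.const_mul ((1 - β : ℂ) * (1 + η))) (fun n hn => by
          simp [hp_def, hn]) hw', Pascu.powerSum_const_mul, Pascu.powerSum_one hw'] at h1
      rw [h1]
      convert hφ w hw using 3
      simp only [hp_def, if_true]
      field_simp
      ring
    have hM := (Pascu.opGenV_mem_classM_iff hμ hν hlam_int hlam_one hfA).1
      (h ⟨_, hfW, rfl⟩) ε hε z hz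
    -- For n ≥ 1 the coefficients of p are constant, so c * p is (1 - β)(1 + η) c, and 1 + c * p
    -- vanishes at the chosen z.
    refine hM ?_
    simp only [hta, hpa]
    rw [← hzero, ← Pascu.powerSum_const_mul]
    congr 2
    funext n
    rcases eq_or_ne n 0 with rfl | hn
    · simp [Pascu.criterionCoeff]
    · simp only [hp_def, if_neg hn]
      ring
  · rintro h _ ⟨f, ⟨hfA, φ, hφ⟩, rfl⟩
    rw [Pascu.opGenV_mem_classM_iff hμ hν hlam_int hlam_one hfA]
    intro ε hε z hz
    have hre := (Pascu.funN_nonneg_iff hμ hν hξ0 hξ1 hβ hρ hlam_int hlam_one hβρ ε).1 (h ε hε)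
    have hd := hfA.1
    have ha := Pascu.discSummable_taylorCoeff hd
    have hexpr := Pascu.classW_expr_eqOn hsum hprod ha (Pascu.eqOn_powerSum_taylorCoeff hd)
    have hs := Pascu.discSummable_one_add_mul_mul ha.shift μ ν
    have h1 := Pascu.one_add_powerSum_mul_taylorCoeff_ne_zero
      (Pascu.discSummable_criterionCoeff (ρ := ρ) (ξ := ξ) hlam_int hμ hν ε)
      (by simp [Pascu.criterionCoeff]) hβ hre (Pascu.differentiableOn_of_eqOn hs hexpr) ?_ hφ hz
    · rwa [Pascu.taylorCoeff_eq_of_eqOn hs hexpr] at h1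
    · refine (hexpr Pascu.zero_mem_unitDisc).trans ?_
      rw [Pascu.powerSum_zero, zero_add, Pascu.taylorCoeff_one, hfA.2.2]
      simp
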